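/- Let $a_0,a_2\in\mathbb{C}$ be constants such that the rational function $\dfrac{a_2w^2+a_0}{1-w^2}$ of $w$ is irreducible, i.e. the polynomials $a_2w^2+a_0$ and $1-w^2$ have no common factor in $\mathbb{C}[w]$. Suppose that the difference equation $$w(z+1)+w(z-1)=\frac{a_2\,w(z)^2+a_0}{1-w(z)^2}$$ (understood as an identity between meromorphic functions of $z$) has a non-constant solution $w$ that is meromorphic in the whole complex plane and of finite order, i.e. $\limsup_{r\to\infty}\dfrac{\log^+T(r,w)}{\log r}<\infty$, where $T(r,w)$ is the Nevanlinna characteristic of $w$. Then $a_2=0$. -/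

import Mathlib

open Filter Polynomial

/-- Order of growth of a meromorphic function on the complex plane,
`limsup_{r → ∞} log⁺ T(r, f) / log r` as an extended real number, where `T(r, f)` is the
Nevanlinna characteristic (proximity function plus counting function of the poles). -/
noncomputable def nevanlinnaOrder (f : ℂ → ℂ) : EReal :=
  limsup (fun r : ℝ =>
    ((Real.posLog (ValueDistribution.characteristic f ⊤ r) / Real.log r : ℝ) : EReal)) atTop

/-- A meromorphic function is of finite order if its order of growth is not `+∞`. -/
def HasFiniteNevanlinnaOrder (f : ℂ → ℂ) : Prop := nevanlinnaOrder f < ⊤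

/-- Equality of two functions on `ℂ` as meromorphic functions: the values agree off a closed
discrete set (the values chosen at poles and at removable singularities are irrelevant). -/
def MeromorphicEq (f g : ℂ → ℂ) : Prop := f =ᶠ[codiscrete ℂ] g

/-- A function on `ℂ` which, as a meromorphic function, is not a constant. -/
def IsNonconstantMeromorphic (f : ℂ → ℂ) : Prop :=
  Meromorphic f ∧ ¬ ∃ c : ℂ, MeromorphicEq f (fun _ => c)

/-! Assume a₂ ≠ 0 and count the ±1-points of `w` against its poles. Irreducibility means a₂ + a₀ ≠
0, so a zero of w - t of order k, t = ±1, makes the right side have a pole of order k, and `w` has a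
pole of order at least k at one of the two neighbours (`posPart_divisor_sub_const_le`). Conversely,
at a pole of `w` the right side tends to -a₂, so finite limits at its two neighbours add up to -a₂
(`add_eq_neg_of_tendsto`). Hence the neighbours of a pole are never one 1-point and one (-1)-point;
and for a sign s with a₂ ≠ 2s they are never both (-s)-points. Giving s-points weight 1 and
(-s)-points weight 2, each pole has neighbours of total weight at most 2, so N(r,s) + 2N(r,-s) ≤
2(1+ε)N(r+1,∞) + K.

The equation also bounds 1/(w - t) by the difference quotients of w - t with shifts ±1. A weak lemma
on the difference quotient, derived from Poisson–Jensen, makes their proximity functions small,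
whence T(r) ≤ N(r,t) + εT(4r) + K for t = ±1.

Together these give 3T(r) ≤ 2(1+ε)T(r+1) + εT(4r) + K for every ε > 0. Then T grows by a fixed
factor per unit step on long intervals, which polynomial growth forbids
(`not_forall_exists_eventually_three_mul_le`). -/

open Complex Metric Real MeromorphicOn in
/-- **Poisson–Jensen formula** on a disk centered at the origin. -/
theorem MeromorphicOn.circleAverage_re_herglotzRieszKernel_mul_log_norm {f : ℂ → ℂ} {R : ℝ} {z : ℂ}
    (hf : MeromorphicOn f (closedBall 0 R))
    (hf' : ∀ u : closedBall (0 : ℂ) R, meromorphicOrderAt f u ≠ ⊤)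
    (hz : z ∈ ball 0 R) (hz₀ : meromorphicOrderAt f z = 0) :
    circleAverage ((re ∘ herglotzRieszKernel 0 z) * (Real.log ‖f ·‖)) 0 R
      = ∑ᶠ u, divisor f (ball 0 R) u * Real.log ‖canonicalFactor R u z‖
        + Real.log ‖meromorphicTrailingCoeffAt f z‖ := by
  have hR : 0 < R := pos_of_mem_ball hz
  obtain ⟨h, D⟩ := hf.exists_ecanonicalDecomp hf'
  have hS : (divisor f (sphere 0 R)).support.Finite := divisor_sphere_support_finite
  have hB : (divisor f (ball 0 R)).support.Finite := hf.divisor_ball_support_finite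
  set K : ℂ → ℝ := re ∘ herglotzRieszKernel 0 z with hK
  have hKc : ContinuousOn K (sphere 0 |R|) :=
    continuous_re.comp_continuousOn (continuousOn_herglotzRieszKernel_sphere hz)
  have hlog : (fun ζ ↦ Real.log ‖f ζ‖) =ᶠ[codiscreteWithin (sphere 0 |R|)]
      (∑ v ∈ hS.toFinset, fun ζ ↦ (divisor f (sphere 0 R) v : ℝ) * Real.log ‖ζ - v‖)
        + fun ζ ↦ Real.log ‖h ζ‖ := by
    rw [abs_of_pos hR]
    filter_upwards [codiscreteWithin_mono sphere_subset_closedBall D.eventuallyEq,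
      codiscreteWithin_mono (Set.subset_univ _) hS.compl_mem_codiscrete,
      self_mem_codiscreteWithin (sphere (0 : ℂ) R)] with ζ h₁ h₂ h₃
    have e₁ : (∏ᶠ u, canonicalFactor R u ^ (-divisor f (ball 0 R) u)) ζ
        = ∏ u ∈ hB.toFinset, canonicalFactor R u ζ ^ (-divisor f (ball 0 R) u) := by
      rw [finprod_eq_prod_of_mulSupport_subset (s := hB.toFinset) _ _]
      · simp
      · intro u hu
        simp only [Function.mem_mulSupport] at hu
        simp only [Set.Finite.coe_toFinset, Function.mem_support]
        intro h0
        simp [h0] at hu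
    have e₂ : (∏ᶠ v, (fun ζ : ℂ ↦ ζ - v) ^ (divisor f (sphere 0 R) v)) ζ
        = ∏ v ∈ hS.toFinset, (ζ - v) ^ (divisor f (sphere 0 R) v) := by
      rw [finprod_eq_prod_of_mulSupport_subset (s := hS.toFinset) _ _]
      · simp
      · intro u hu
        simp only [Function.mem_mulSupport] at hu
        simp only [Set.Finite.coe_toFinset, Function.mem_support]
        intro h0
        simp [h0] at hu
    -- Canonical factors have modulus one on the circle, so interior zeros and poles drop out of the
    -- boundary average; they return only when log ‖h z‖ is expressed through `f`.
    have n₁ : ‖∏ u ∈ hB.toFinset, canonicalFactor R u ζ ^ (-divisor f (ball 0 R) u)‖ = 1 := by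
      rw [norm_prod]
      refine Finset.prod_eq_one fun u hu ↦ ?_
      have hu' : u ∈ ball (0 : ℂ) R :=
        (divisor f (ball 0 R)).supportWithinDomain (hB.mem_toFinset.1 hu)
      rw [norm_zpow, norm_canonicalFactor_eval_circle_eq_one hu' h₃, one_zpow]
    have n₂ : ∀ v ∈ hS.toFinset, ‖ζ - v‖ ^ (divisor f (sphere 0 R) v) ≠ 0 := by
      intro v hv
      refine zpow_ne_zero _ ?_
      rw [norm_ne_zero_iff, sub_ne_zero]
      rintro rfl
      exact h₂ (hS.mem_toFinset.1 hv)
    have hh : ‖h ζ‖ ≠ 0 := norm_ne_zero_iff.2 (D.ne_zero ζ (sphere_subset_closedBall h₃))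
    simp only [Pi.add_apply, Finset.sum_apply]
    rw [h₁, Pi.smul_apply', Pi.mul_apply, e₁, e₂, smul_eq_mul, norm_mul, norm_mul, n₁, one_mul,
      norm_prod]
    simp only [norm_zpow]
    rw [Real.log_mul (Finset.prod_ne_zero_iff.2 n₂) hh, Real.log_prod n₂]
    simp only [Real.log_zpow]
  have iS : ∀ v ∈ hS.toFinset, CircleIntegrable
      (fun ζ ↦ (divisor f (sphere 0 R) v : ℝ) • (K * (Real.log ‖· - v‖)) ζ) 0 R := by
    intro v _
    exact ((circleIntegrable_log_norm_sub_const R).continuousOn_mul hKc).const_smul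
  have ih : CircleIntegrable (K * (Real.log ‖h ·‖)) 0 R := by
    refine CircleIntegrable.continuousOn_mul ?_ hKc
    refine MeromorphicOn.circleIntegrable_log_norm fun x hx ↦ (D.analyticOnNhd x ?_).meromorphicAt
    rw [abs_of_pos hR] at hx
    exact sphere_subset_closedBall hx
  have hPh : circleAverage (K * (Real.log ‖h ·‖)) 0 R = Real.log ‖h z‖ :=
    InnerProductSpace.HarmonicOnNhd.circleAverage_re_herglotzRieszKernel_smul
      (fun x hx ↦ (D.analyticOnNhd x hx).harmonicAt_log_norm (D.ne_zero x hx)) hz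
  calc circleAverage (K * (Real.log ‖f ·‖)) 0 R
      = circleAverage ((fun ζ ↦ ∑ v ∈ hS.toFinset,
          (divisor f (sphere 0 R) v : ℝ) • (K * (Real.log ‖· - v‖)) ζ)
          + K * (Real.log ‖h ·‖)) 0 R := by
        refine circleAverage_congr_codiscreteWithin ?_ hR.ne'
        filter_upwards [hlog] with ζ hζ
        simp only [Pi.mul_apply, Pi.add_apply, Finset.sum_apply, smul_eq_mul] at hζ ⊢
        rw [hζ, mul_add, Finset.mul_sum]
        congr 1
        exact Finset.sum_congr rfl fun v _ ↦ by ring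
    _ = ∑ v ∈ hS.toFinset, (divisor f (sphere 0 R) v : ℝ) * Real.log ‖z - v‖
          + Real.log ‖h z‖ := by
        rw [circleAverage_add (CircleIntegrable.fun_sum _ iS) ih, hPh, circleAverage_fun_sum iS]
        congr 1
        refine Finset.sum_congr rfl fun v hv ↦ ?_
        have hv' : v ∈ sphere (0 : ℂ) R :=
          (divisor f (sphere 0 R)).supportWithinDomain (hS.mem_toFinset.1 hv)
        rw [circleAverage_fun_smul, circleAverage_re_herglotzRieszKernel_mul_log hv' hz, smul_eq_mul]
    _ = _ := by
        rw [D.log_norm_eq (ball_subset_closedBall hz) hz₀ hR,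
          finsum_eq_sum_of_support_subset (s := hS.toFinset)
            (fun i ↦ (divisor f (sphere 0 R) i : ℝ) * Real.log ‖z - i‖) (by intro _ _; simp_all)]
        ring

/-! ### Uniform circle averages of a logarithmic singularity -/

section LogKernel

open MeasureTheory Real

/-- The sine vanishes only on a null set. -/
lemma ae_sin_ne_zero : ∀ᵐ θ : ℝ, Real.sin θ ≠ 0 := by
  have : {θ : ℝ | Real.sin θ = 0}.Countable := by
    refine (Set.countable_range fun n : ℤ ↦ (n : ℝ) * π).mono fun θ hθ ↦ ?_
    obtain ⟨n, hn⟩ := Real.sin_eq_zero_iff.1 hθ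
    exact ⟨n, hn⟩
  simpa [ae_iff] using this.measure_zero volume

lemma intervalIntegrable_log_one_add_inv_sin {r : ℝ} (hr : 0 < r) (a b : ℝ) :
    IntervalIntegrable (fun θ ↦ Real.log (1 + (r * |Real.sin θ|)⁻¹)) volume a b := by
  have h₁ : IntervalIntegrable (fun θ ↦ Real.log (r * |Real.sin θ| + 1)) volume a b := by
    refine Continuous.intervalIntegrable ?_ a b
    refine Continuous.log (by fun_prop) fun θ ↦ ?_
    positivity
  have h₂ : IntervalIntegrable (fun θ ↦ Real.log (r * |Real.sin θ| + 1)
      - (Real.log r + Real.log (Real.sin θ))) volume a b :=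
    h₁.sub ((intervalIntegrable_const).add intervalIntegrable_log_sin)
  refine h₂.congr_ae ?_
  filter_upwards [ae_restrict_of_ae ae_sin_ne_zero] with θ hθ
  have h0 : 0 < |Real.sin θ| := abs_pos.2 hθ
  have : 1 + (r * |Real.sin θ|)⁻¹ = (r * |Real.sin θ| + 1) / (r * |Real.sin θ|) := by
    field_simp
  rw [this, Real.log_div (by positivity) (by positivity), Real.log_mul hr.ne' h0.ne', Real.log_abs]

lemma circleIntegrable_log_one_add_inv_norm_sub (a : ℂ) (r : ℝ) :
    CircleIntegrable (fun z ↦ Real.log (1 + ‖z - a‖⁻¹)) 0 r := by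
  have h₁ : CircleIntegrable (fun z ↦ Real.log (‖z - a‖ + 1)) 0 r := by
    refine Continuous.intervalIntegrable ?_ _ _
    refine Continuous.log (by fun_prop) fun θ ↦ ?_
    positivity
  refine CircleIntegrable.congr_codiscreteWithin ?_
    (h₁.sub (circleIntegrable_log_norm_sub_const (a := a) r))
  filter_upwards [compl_singleton_mem_codiscreteWithin a] with z hz
  have h0 : 0 < ‖z - a‖ := norm_pos_iff.2 (sub_ne_zero.2 hz)
  have : 1 + ‖z - a‖⁻¹ = (‖z - a‖ + 1) / ‖z - a‖ := by
    field_simp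
  rw [this, Real.log_div (by positivity) (by positivity)]
  rfl

/-- Rotating by -arg a puts `a` on the nonnegative real axis, where the imaginary part of the
difference is r sin θ. The bound no longer involves `a`, which is the source of uniformity. -/
lemma mul_abs_sin_le_norm_circleMap_sub (a : ℂ) {r : ℝ} (hr : 0 < r) (θ : ℝ) :
    r * |Real.sin θ| ≤ ‖circleMap 0 r (θ + a.arg) - a‖ := by
  have h₁ : circleMap 0 r (θ + a.arg) - a
      = (circleMap 0 r θ - (‖a‖ : ℂ)) * Complex.exp (a.arg * Complex.I) := by
    conv_lhs => rw [← Complex.norm_mul_exp_arg_mul_I a]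
    simp only [circleMap, zero_add, Complex.ofReal_add, add_mul, Complex.exp_add, sub_mul]
    simp [mul_assoc]
  rw [h₁, norm_mul, Complex.norm_exp_ofReal_mul_I, mul_one]
  refine le_trans (le_of_eq ?_) (Complex.abs_im_le_norm _)
  simp [circleMap, Complex.exp_ofReal_mul_I_im, abs_mul, abs_of_pos hr]

/-- Circle averages of `log (1 + 1 / |z - a|)` tend to zero uniformly in `a` as the radius grows. -/
theorem exists_tendsto_zero_circleAverage_log_one_add_inv_le :
    ∃ η : ℝ → ℝ, Tendsto η atTop (nhds 0) ∧ ∀ r > 0, ∀ a : ℂ,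
      circleAverage (fun z ↦ Real.log (1 + ‖z - a‖⁻¹)) 0 r ≤ η r := by
  refine ⟨fun r ↦ (2 * π)⁻¹ * ∫ θ in (0)..(2 * π), Real.log (1 + (r * |Real.sin θ|)⁻¹), ?_, ?_⟩
  · have hlim : Tendsto (fun r : ℝ ↦ ∫ θ in (0)..(2 * π), Real.log (1 + (r * |Real.sin θ|)⁻¹))
        atTop (nhds (∫ θ in (0)..(2 * π), (0 : ℝ))) := by
      -- The integrand decreases in `r`, so its value at r = 1 dominates.
      refine intervalIntegral.tendsto_integral_filter_of_dominated_convergence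
        (fun θ ↦ Real.log (1 + (1 * |Real.sin θ|)⁻¹)) ?_ ?_
        (intervalIntegrable_log_one_add_inv_sin one_pos _ _) ?_
      · filter_upwards [eventually_gt_atTop 0] with r hr
        exact (intervalIntegrable_iff.1
          (intervalIntegrable_log_one_add_inv_sin hr _ _)).aestronglyMeasurable
      · filter_upwards [eventually_ge_atTop 1] with r hr
        filter_upwards [ae_sin_ne_zero] with θ hθ _
        have h0 : 0 < |Real.sin θ| := abs_pos.2 hθ
        have hr0 : 0 < r := by linarith
        rw [Real.norm_eq_abs, abs_of_nonneg (Real.log_nonneg (by simp; positivity))]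
        gcongr
      · filter_upwards [ae_sin_ne_zero] with θ hθ _
        have h0 : 0 < |Real.sin θ| := abs_pos.2 hθ
        have h₁ : Tendsto (fun r : ℝ ↦ 1 + (r * |Real.sin θ|)⁻¹) atTop (nhds (1 + 0)) :=
          (tendsto_inv_atTop_zero.comp (tendsto_id.atTop_mul_const h0)).const_add 1
        simpa using h₁.log (by norm_num)
    simpa using hlim.const_mul (2 * π)⁻¹
  · intro r hr a
    rw [circleAverage_eq_integral_add a.arg, smul_eq_mul]
    refine mul_le_mul_of_nonneg_left ?_ (by positivity)
    refine intervalIntegral.integral_mono_ae (by positivity) ?_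
      (intervalIntegrable_log_one_add_inv_sin hr _ _) ?_
    · have hp : Function.Periodic (fun θ ↦ Real.log (1 + ‖circleMap 0 r θ - a‖⁻¹)) (2 * π) :=
        fun θ ↦ by simp [periodic_circleMap 0 r θ]
      have := hp.intervalIntegrable₀ (by positivity)
        (circleIntegrable_log_one_add_inv_norm_sub a r) (0 + a.arg) (2 * π + a.arg)
      simpa using this.comp_add_right a.arg
    · filter_upwards [ae_sin_ne_zero] with θ hθ
      have h0 : 0 < |Real.sin θ| := abs_pos.2 hθ
      have := mul_abs_sin_le_norm_circleMap_sub a hr θ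
      have h1 : 0 < r * |Real.sin θ| := by positivity
      have h2 : 0 < ‖circleMap 0 r (θ + a.arg) - a‖ := h1.trans_le this
      gcongr

end LogKernel

/-! ### Logarithmic counting functions as finite sums -/

section LogCountingKernel

open Real Function.locallyFinsuppWithin Metric

/-- The contribution of a simple point at `z` to a logarithmic counting function of radius `r`. -/
noncomputable def logCountingKernel (r : ℝ) (z : ℂ) : ℝ :=
  if z = 0 then Real.log r else log⁺ (r / ‖z‖)

lemma logCountingKernel_nonneg {r : ℝ} (hr : 1 ≤ r) (z : ℂ) : 0 ≤ logCountingKernel r z := by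
  unfold logCountingKernel
  split_ifs
  · exact Real.log_nonneg hr
  · exact posLog_nonneg

lemma logCountingKernel_of_lt_norm {r : ℝ} (hr : 1 ≤ r) {z : ℂ} (hz : r < ‖z‖) :
    logCountingKernel r z = 0 := by
  have h0 : 0 < ‖z‖ := by linarith
  rw [logCountingKernel, if_neg (norm_pos_iff.1 h0), posLog_eq_zero_iff,
    abs_of_nonneg (by positivity), div_le_one h0]
  exact hz.le

lemma logCountingKernel_of_norm_le {r : ℝ} {z : ℂ} (hz : ‖z‖ ≤ r) (h0 : z ≠ 0) :
    logCountingKernel r z = Real.log (r / ‖z‖) := by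
  have h0' : 0 < ‖z‖ := norm_pos_iff.2 h0
  rw [logCountingKernel, if_neg h0, posLog_eq_log]
  rw [abs_of_nonneg (div_nonneg (h0'.le.trans hz) h0'.le)]
  exact (one_le_div h0').2 hz

lemma log_two_le_logCountingKernel {r : ℝ} (hr : 1 ≤ r) {z : ℂ} (hz : ‖z‖ ≤ r) :
    Real.log 2 ≤ logCountingKernel (2 * r) z := by
  rcases eq_or_ne z 0 with rfl | h0
  · rw [logCountingKernel, if_pos rfl]
    exact Real.log_le_log two_pos (by linarith)
  · rw [logCountingKernel_of_norm_le (by linarith) h0]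
    have h0' : 0 < ‖z‖ := norm_pos_iff.2 h0
    refine Real.log_le_log two_pos ?_
    rw [le_div_iff₀ h0']
    linarith

/-- A logarithmic counting function as a finite sum of kernels. -/
lemma logCounting_eq_sum_logCountingKernel (D : Function.locallyFinsupp ℂ ℤ) {r : ℝ} (hr : 1 ≤ r)
    (s : Finset ℂ) (hs : ∀ z, D z ≠ 0 → ‖z‖ ≤ r → z ∈ s) :
    logCounting D r = ∑ z ∈ s, (D z : ℝ) * logCountingKernel r z := by
  classical
  have hr0 : 0 ≤ r := by linarith
  have hzero : ((D 0 : ℤ) : ℝ) * Real.log r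
      = ∑ z ∈ s, if z = 0 then ((D z : ℤ) : ℝ) * Real.log r else 0 := by
    rw [Finset.sum_ite_eq']
    split_ifs with h
    · rfl
    · have : D 0 = 0 := by
        by_contra h'
        exact h (hs 0 h' (by simpa using hr0))
      simp [this]
  have hsupp : (fun z ↦ (toClosedBall r D z : ℝ) * Real.log (r * ‖z‖⁻¹)).support ⊆ s := by
    intro z hz
    simp only [Function.mem_support] at hz
    have h1 : toClosedBall r D z ≠ 0 := fun h ↦ hz (by simp [h])
    have h2 : z ∈ closedBall (0 : ℂ) |r| := (toClosedBall r D).supportWithinDomain h1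
    rw [toClosedBall_eval_within _ h2] at h1
    rw [mem_closedBall_zero_iff, abs_of_nonneg hr0] at h2
    exact hs z h1 h2
  simp only [logCounting, AddMonoidHom.coe_mk, ZeroHom.coe_mk]
  rw [finsum_eq_sum_of_support_subset _ hsupp, hzero, ← Finset.sum_add_distrib]
  refine Finset.sum_congr rfl fun z _ ↦ ?_
  rcases eq_or_ne z 0 with rfl | h0
  · simp [logCountingKernel]
  rcases le_or_gt ‖z‖ r with hz | hz
  · rw [toClosedBall_eval_within _ (by simpa [abs_of_nonneg hr0] using hz),
      logCountingKernel_of_norm_le hz h0, if_neg h0, add_zero, div_eq_mul_inv]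
  · have h2 : toClosedBall r D z = 0 := by
      apply Function.locallyFinsuppWithin.apply_eq_zero_of_notMem
      simpa [abs_of_nonneg hr0] using hz
    simp [h2, h0, logCountingKernel_of_lt_norm hr hz]

/-- The points of a divisor in a closed ball, as a finite set. -/
lemma finite_support_inter_closedBall (D : Function.locallyFinsupp ℂ ℤ) (r : ℝ) :
    {z : ℂ | D z ≠ 0 ∧ ‖z‖ ≤ r}.Finite := by
  refine ((toClosedBall r D).finiteSupport (isCompact_closedBall 0 |r|)).subset ?_
  rintro z ⟨h1, h2⟩
  have h3 : z ∈ closedBall (0 : ℂ) |r| := by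
    simpa using h2.trans (le_abs_self r)
  rwa [Function.mem_support, toClosedBall_eval_within _ h3]

/-- Each point of modulus at most `r` contributes at least log (2r/r) = log 2 at radius 2r. This
turns a characteristic bound into a bound on the number of points. -/
lemma sum_mul_log_two_le_logCounting {D : Function.locallyFinsupp ℂ ℤ} (hD : 0 ≤ D) {r : ℝ}
    (hr : 1 ≤ r) (s : Finset ℂ) (hs : ∀ z ∈ s, ‖z‖ ≤ r) :
    (∑ z ∈ s, (D z : ℝ)) * Real.log 2 ≤ logCounting D (2 * r) := by
  classical
  have hD' : ∀ z, (0 : ℝ) ≤ D z := fun z ↦ by exact_mod_cast hD z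
  rw [logCounting_eq_sum_logCountingKernel D (by linarith)
    (s ∪ (finite_support_inter_closedBall D (2 * r)).toFinset) (fun z h1 h2 ↦ by simp [h1, h2]),
    Finset.sum_mul]
  calc ∑ z ∈ s, (D z : ℝ) * Real.log 2
      ≤ ∑ z ∈ s, (D z : ℝ) * logCountingKernel (2 * r) z :=
        Finset.sum_le_sum fun z hz ↦
          mul_le_mul_of_nonneg_left (log_two_le_logCountingKernel hr (hs z hz)) (hD' z)
    _ ≤ _ := Finset.sum_le_sum_of_subset_of_nonneg Finset.subset_union_left fun z _ _ ↦
        mul_nonneg (hD' z) (logCountingKernel_nonneg (by linarith) z)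

end LogCountingKernel

/-! ### Variation of log |f| over a unit step -/

section LogDifference

open Real Metric Complex MeromorphicOn

lemma log_div_le_log_one_add {x y δ : ℝ} (hx : 0 < x) (hy : 0 < y) (hδ : 0 ≤ δ)
    (h : |x - y| ≤ δ) :
    |Real.log x - Real.log y| ≤ Real.log (1 + δ / x) + Real.log (1 + δ / y) := by
  have key : ∀ {x y : ℝ}, 0 < x → 0 < y → |x - y| ≤ δ →
      Real.log x - Real.log y ≤ Real.log (1 + δ / y) := by
    intro x y hx hy h
    rw [← Real.log_div hx.ne' hy.ne']
    refine Real.log_le_log (by positivity) ?_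
    rw [div_le_iff₀ hy, add_mul, div_mul_cancel₀ _ hy.ne']
    linarith [le_abs_self (x - y)]
  have n₁ : 0 ≤ Real.log (1 + δ / x) := Real.log_nonneg (by simp; positivity)
  have n₂ : 0 ≤ Real.log (1 + δ / y) := Real.log_nonneg (by simp; positivity)
  rw [abs_le]
  constructor
  · linarith [key hy hx (by rwa [abs_sub_comm])]
  · linarith [key hx hy h]

/-- The factor is (R² - ūx)/(R(x - u)). Its numerator has modulus at least 3Rr/4 and changes by at
most R, which costs O(1/r); the change of log ‖x - u‖ gives the two logarithmic terms. -/
lemma abs_log_norm_canonicalFactor_sub_le {R r : ℝ} {u z z' : ℂ} (hr : 4 ≤ r) (hR : R = 2 * r)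
    (hu : u ∈ ball 0 R) (hz : ‖z‖ = r) (hzz : ‖z' - z‖ = 1) (hzu : z ≠ u) (hzu' : z' ≠ u) :
    |Real.log ‖canonicalFactor R u z'‖ - Real.log ‖canonicalFactor R u z‖|
      ≤ 3 / r + (Real.log (1 + ‖z' - u‖⁻¹) + Real.log (1 + ‖z - u‖⁻¹)) := by
  have hr0 : 0 < r := by linarith
  have hR0 : 0 < R := by linarith
  have hu' : ‖u‖ < R := by simpa using hu
  have hz' : ‖z'‖ ≤ r + 1 := by
    have := norm_add_le (z' - z) z
    rw [sub_add_cancel, hzz, hz] at this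
    linarith
  have low : ∀ {x : ℂ}, ‖x‖ ≤ r + 1 → R * (3 / 4 * r) ≤ ‖(R : ℂ) ^ 2 - (starRingEnd ℂ) u * x‖ := by
    intro x hx
    have h1 := norm_sub_norm_le ((R : ℂ) ^ 2) ((starRingEnd ℂ) u * x)
    have h2 : ‖(starRingEnd ℂ) u * x‖ ≤ R * (r + 1) := by
      rw [norm_mul, RCLike.norm_conj]
      gcongr
    have h3 : ‖(R : ℂ) ^ 2‖ = R * (2 * r) := by
      rw [norm_pow, Complex.norm_real, Real.norm_eq_abs, abs_of_pos hR0, sq, ← hR]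
    rw [h3] at h1
    -- This is where r ≥ 4 enters; 2r - 5r/4 = 3r/4.
    have h4 : R * (r + 1) ≤ R * (5 / 4 * r) := by gcongr; linarith
    linarith
  have pos : 0 < R * (3 / 4 * r) := by positivity
  have expand : ∀ {x : ℂ}, ‖x‖ ≤ r + 1 → x ≠ u → Real.log ‖canonicalFactor R u x‖
      = Real.log ‖(R : ℂ) ^ 2 - (starRingEnd ℂ) u * x‖ - (Real.log R + Real.log ‖x - u‖) := by
    intro x hx hxu
    have h1 : 0 < ‖x - u‖ := norm_pos_iff.2 (sub_ne_zero.2 hxu)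
    rw [canonicalFactor_apply, norm_div, norm_mul, Complex.norm_real, Real.norm_eq_abs,
      abs_of_pos hR0, Real.log_div (pos.trans_le (low hx)).ne' (by positivity),
      Real.log_mul hR0.ne' h1.ne']
  rw [expand hz' hzu', expand (by linarith) hzu]
  have a₁ := log_div_le_log_one_add (pos.trans_le (low hz'))
    (pos.trans_le (low (x := z) (by linarith))) hR0.le (by
      refine (abs_norm_sub_norm_le _ _).trans ?_
      have : (R : ℂ) ^ 2 - (starRingEnd ℂ) u * z' - ((R : ℂ) ^ 2 - (starRingEnd ℂ) u * z)
        = -((starRingEnd ℂ) u * (z' - z)) := by ring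
      rw [this, norm_neg, norm_mul, hzz, mul_one, RCLike.norm_conj]
      exact hu'.le)
  have a₂ := log_div_le_log_one_add (norm_pos_iff.2 (sub_ne_zero.2 hzu'))
    (norm_pos_iff.2 (sub_ne_zero.2 hzu)) zero_le_one (by
      refine (abs_norm_sub_norm_le _ _).trans ?_
      rw [sub_sub_sub_cancel_right, hzz])
  have small : ∀ {x : ℂ}, ‖x‖ ≤ r + 1 →
      Real.log (1 + R / ‖(R : ℂ) ^ 2 - (starRingEnd ℂ) u * x‖) ≤ 3 / 2 / r := by
    intro x hx
    have h1 := low hx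
    have h2 : 0 < 1 + R / ‖(R : ℂ) ^ 2 - (starRingEnd ℂ) u * x‖ := by positivity
    refine (Real.log_le_sub_one_of_pos h2).trans ?_
    rw [add_sub_cancel_left]
    calc R / ‖(R : ℂ) ^ 2 - (starRingEnd ℂ) u * x‖ ≤ R / (R * (3 / 4 * r)) := by gcongr
      _ = 4 / 3 / r := by field_simp
      _ ≤ 3 / 2 / r := div_le_div_of_nonneg_right (by norm_num) hr0.le
  have s₁ := small hz'
  have s₂ := small (x := z) (by linarith)
  have s₃ : 3 / r = 3 / 2 / r + 3 / 2 / r := by ring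
  simp only [one_div] at a₂
  rw [s₃]
  rw [abs_le] at a₁ a₂ ⊢
  constructor <;> linarith [a₁.1, a₁.2, a₂.1, a₂.2]

lemma abs_re_herglotzRieszKernel_sub_le {R r : ℝ} {z z' ζ : ℂ} (hr : 4 ≤ r) (hR : R = 2 * r)
    (hζ : ‖ζ‖ = R) (hz : ‖z‖ = r) (hzz : ‖z' - z‖ = 1) :
    |(herglotzRieszKernel 0 z' ζ).re - (herglotzRieszKernel 0 z ζ).re| ≤ 6 / r := by
  have hr0 : 0 < r := by linarith
  have hz' : ‖z'‖ ≤ r + 1 := by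
    have := norm_add_le (z' - z) z
    rw [sub_add_cancel, hzz, hz] at this
    linarith
  have l₁ : r ≤ ‖ζ - z‖ := by
    have := norm_sub_norm_le ζ z
    linarith
  have l₂ : 3 / 4 * r ≤ ‖ζ - z'‖ := by
    have := norm_sub_norm_le ζ z'
    linarith
  have n₁ : ζ - z ≠ 0 := norm_pos_iff.1 (by linarith)
  have n₂ : ζ - z' ≠ 0 := norm_pos_iff.1 (by nlinarith)
  have e : herglotzRieszKernel 0 z' ζ - herglotzRieszKernel 0 z ζ
      = 2 * ζ * (z' - z) / ((ζ - z') * (ζ - z)) := by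
    simp only [herglotzRieszKernel_def, sub_zero]
    field_simp
    ring
  rw [← Complex.sub_re, e]
  refine (Complex.abs_re_le_norm _).trans ?_
  rw [norm_div, norm_mul, norm_mul, norm_mul, hzz, hζ, hR]
  simp only [Complex.norm_ofNat, mul_one]
  calc 2 * (2 * r) / (‖ζ - z'‖ * ‖ζ - z‖) ≤ 2 * (2 * r) / (3 / 4 * r * r) := by gcongr
    _ = 16 / 3 / r := by field_simp; norm_num
    _ ≤ 6 / r := by gcongr; norm_num

/-- Pointwise bound for the difference of `log |f|` at two points at distance one. -/
theorem abs_log_norm_sub_log_norm_le {f : ℂ → ℂ} {R r : ℝ} {z z' : ℂ} (hr : 4 ≤ r)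
    (hR : R = 2 * r) (hf : Meromorphic f) (hf' : ∀ u, meromorphicOrderAt f u ≠ ⊤)
    (hz : ‖z‖ = r) (hzz : ‖z' - z‖ = 1)
    (han : AnalyticAt ℂ f z) (hne : f z ≠ 0) (han' : AnalyticAt ℂ f z') (hne' : f z' ≠ 0)
    (s : Finset ℂ) (hs : (divisor f (ball 0 R)).support = s) :
    |Real.log ‖f z'‖ - Real.log ‖f z‖| ≤ 6 / r * circleAverage |(Real.log ‖f ·‖)| 0 R
      + ∑ u ∈ s, |(divisor f (ball 0 R) u : ℝ)| *
        (3 / r + (Real.log (1 + ‖z' - u‖⁻¹) + Real.log (1 + ‖z - u‖⁻¹))) := by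
  have hr0 : 0 < r := by linarith
  have hR0 : 0 < R := by linarith
  have hz' : ‖z'‖ ≤ r + 1 := by
    have := norm_add_le (z' - z) z
    rw [sub_add_cancel, hzz, hz] at this
    linarith
  have hzb : z ∈ ball (0 : ℂ) R := by
    rw [mem_ball_zero_iff]; linarith
  have hzb' : z' ∈ ball (0 : ℂ) R := by
    rw [mem_ball_zero_iff]; linarith
  have ord : ∀ {x : ℂ}, AnalyticAt ℂ f x → f x ≠ 0 → meromorphicOrderAt f x = 0 := by
    intro x h1 h2
    exact (h1.meromorphicNFAt).meromorphicOrderAt_eq_zero_iff.2 h2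
  -- Poisson–Jensen solved for log ‖f x‖. Subtracting it at the two points leaves a kernel
  -- difference and a sum of canonical factor differences.
  have PJ : ∀ {x : ℂ}, x ∈ ball (0 : ℂ) R → AnalyticAt ℂ f x → f x ≠ 0 → Real.log ‖f x‖
      = circleAverage ((re ∘ herglotzRieszKernel 0 x) * (Real.log ‖f ·‖)) 0 R
        - ∑ u ∈ s, (divisor f (ball 0 R) u : ℝ) * Real.log ‖canonicalFactor R u x‖ := by
    intro x h1 h2 h3
    have := circleAverage_re_herglotzRieszKernel_mul_log_norm (f := f) (R := R) hf.meromorphicOn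
      (fun u ↦ hf' u) h1 (ord h2 h3)
    rw [finsum_eq_sum_of_support_subset (s := s) _ (by
      rw [← hs]; intro u hu h0; exact hu (by simp [h0])),
      h2.meromorphicTrailingCoeffAt_of_ne_zero h3] at this
    linarith
  have hlogI : CircleIntegrable (Real.log ‖f ·‖) 0 R := hf.meromorphicOn.circleIntegrable_log_norm
  have KI : ∀ {x : ℂ}, x ∈ ball (0 : ℂ) R →
      CircleIntegrable ((re ∘ herglotzRieszKernel 0 x) * (Real.log ‖f ·‖)) 0 R := fun hx ↦
    hlogI.continuousOn_mul (continuous_re.comp_continuousOn (continuousOn_herglotzRieszKernel_sphere hx))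
  rw [PJ hzb' han' hne', PJ hzb han hne]
  have b₁ : |circleAverage ((re ∘ herglotzRieszKernel 0 z') * (Real.log ‖f ·‖)) 0 R
      - circleAverage ((re ∘ herglotzRieszKernel 0 z) * (Real.log ‖f ·‖)) 0 R|
      ≤ 6 / r * circleAverage |(Real.log ‖f ·‖)| 0 R := by
    rw [← circleAverage_sub (KI hzb') (KI hzb)]
    refine abs_circleAverage_le_circleAverage_abs.trans ?_
    rw [← smul_eq_mul (6 / r) (circleAverage _ _ _), ← circleAverage_smul]
    refine circleAverage_mono ((KI hzb').sub (KI hzb)).abs hlogI.abs.const_smul fun ζ hζ ↦ ?_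
    rw [abs_of_pos hR0, mem_sphere_zero_iff_norm] at hζ
    simp only [Pi.abs_apply, Pi.sub_apply, Pi.mul_apply, Function.comp_apply, Pi.smul_apply,
      smul_eq_mul, ← sub_mul, abs_mul]
    gcongr
    exact abs_re_herglotzRieszKernel_sub_le hr hR hζ hz hzz
  have b₂ : |∑ u ∈ s, (divisor f (ball 0 R) u : ℝ) * Real.log ‖canonicalFactor R u z'‖
      - ∑ u ∈ s, (divisor f (ball 0 R) u : ℝ) * Real.log ‖canonicalFactor R u z‖|
      ≤ ∑ u ∈ s, |(divisor f (ball 0 R) u : ℝ)| *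
        (3 / r + (Real.log (1 + ‖z' - u‖⁻¹) + Real.log (1 + ‖z - u‖⁻¹))) := by
    rw [← Finset.sum_sub_distrib]
    refine (Finset.abs_sum_le_sum_abs _ _).trans (Finset.sum_le_sum fun u hu ↦ ?_)
    have hu' : divisor f (ball 0 R) u ≠ 0 := by
      have : u ∈ (divisor f (ball 0 R)).support := by rw [hs]; exact hu
      exact this
    have hub : u ∈ ball (0 : ℂ) R := (divisor f (ball 0 R)).supportWithinDomain hu'
    have hxu : ∀ {x : ℂ}, AnalyticAt ℂ f x → f x ≠ 0 → x ≠ u := by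
      rintro x h1 h2 rfl
      apply hu'
      rw [divisor_apply hf.meromorphicOn hub, ord h1 h2]
      rfl
    rw [← mul_sub, abs_mul]
    gcongr
    exact abs_log_norm_canonicalFactor_sub_le hr hR hub hz hzz (hxu han hne) (hxu han' hne')
  rw [abs_le] at b₁ b₂ ⊢
  constructor <;> linarith [b₁.1, b₁.2, b₂.1, b₂.2]

end LogDifference

/-! ### Translations and codiscrete sets -/

section Translation

open Topology

lemma eventually_codiscrete_iff {p : ℂ → Prop} :
    (∀ᶠ z in codiscrete ℂ, p z) ↔ ∀ x, ∀ᶠ z in 𝓝[≠] x, p z := by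
  simp only [Filter.Eventually, mem_codiscrete, disjoint_principal_right, compl_compl]

lemma tendsto_add_const_nhdsNE (c x : ℂ) : Tendsto (fun z ↦ z + c) (𝓝[≠] x) (𝓝[≠] (x + c)) := by
  refine tendsto_nhdsWithin_iff.2 ⟨?_, ?_⟩
  · exact ((continuous_add_const c).tendsto x).mono_left nhdsWithin_le_nhds
  · filter_upwards [self_mem_nhdsWithin] with z hz
    simpa using hz

lemma Filter.Eventually.codiscrete_comp_add_const {p : ℂ → Prop}
    (h : ∀ᶠ z in codiscrete ℂ, p z) (c : ℂ) : ∀ᶠ z in codiscrete ℂ, p (z + c) := by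
  rw [eventually_codiscrete_iff] at h ⊢
  exact fun x ↦ (tendsto_add_const_nhdsNE c x).eventually (h (x + c))

lemma Meromorphic.comp_add_const {f : ℂ → ℂ} (hf : Meromorphic f) (c : ℂ) :
    Meromorphic fun z ↦ f (z + c) :=
  Meromorphic.meromorphic_fun_comp_add_const_iff_meromorphic.2 hf

end Translation

/-! ### Lemma on the difference quotient -/

section DifferenceQuotient

open Real Metric MeromorphicOn ValueDistribution Topology

/-- Exceptional points on the circle do not affect the average, so `g` may be replaced by min g h,
which is below `h` everywhere. -/
lemma circleAverage_mono_codiscrete {g h : ℂ → ℝ} {r : ℝ} (hr : r ≠ 0)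
    (hg : CircleIntegrable g 0 r) (hh : CircleIntegrable h 0 r)
    (hle : ∀ᶠ z in codiscreteWithin (sphere (0 : ℂ) |r|), g z ≤ h z) :
    circleAverage g 0 r ≤ circleAverage h 0 r := by
  have he : g =ᶠ[codiscreteWithin (sphere (0 : ℂ) |r|)] fun z ↦ min (g z) (h z) := by
    filter_upwards [hle] with z hz
    exact (min_eq_left hz).symm
  rw [circleAverage_congr_codiscreteWithin he hr]
  exact circleAverage_mono (hg.congr_codiscreteWithin he) hh fun z _ ↦ min_le_right _ _

lemma circleAverage_abs_log_norm {f : ℂ → ℂ} (hf : Meromorphic f) (R : ℝ) :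
    circleAverage |(Real.log ‖f ·‖)| 0 R = proximity f ⊤ R + proximity f⁻¹ ⊤ R := by
  rw [proximity_top, proximity_top, ← circleAverage_add
    hf.meromorphicOn.circleIntegrable_posLog_norm hf.inv.meromorphicOn.circleIntegrable_posLog_norm]
  congr 1
  ext z
  simp only [Pi.abs_apply, Pi.add_apply, Pi.inv_apply, norm_inv]
  change |Real.log ‖f z‖| = max 0 (Real.log ‖f z‖) + max 0 (Real.log ‖f z‖⁻¹)
  rw [Real.log_inv]
  rcases le_total 0 (Real.log ‖f z‖) with h | h
  · rw [abs_of_nonneg h, max_eq_right h, max_eq_left (by linarith), add_zero]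
  · rw [abs_of_nonpos h, max_eq_left h, max_eq_right (by linarith), zero_add]

lemma posLog_norm_div_le {a b : ℂ} (ha : a ≠ 0) (hb : b ≠ 0) :
    log⁺ ‖a / b‖ ≤ |Real.log ‖a‖ - Real.log ‖b‖| := by
  change max 0 (Real.log ‖a / b‖) ≤ _
  rw [norm_div, Real.log_div (norm_ne_zero_iff.2 ha) (norm_ne_zero_iff.2 hb)]
  exact max_le (abs_nonneg _) (le_abs_self _)

lemma Meromorphic.eventually_codiscrete_analyticAt_ne_zero {f : ℂ → ℂ} (hf : Meromorphic f)
    (hf' : ∀ u, meromorphicOrderAt f u ≠ ⊤) :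
    ∀ᶠ z in codiscrete ℂ, AnalyticAt ℂ f z ∧ f z ≠ 0 := by
  rw [eventually_codiscrete_iff]
  intro x
  exact (hf x).eventually_analyticAt.and
    ((meromorphicOrderAt_ne_top_iff_eventually_ne_zero (hf x)).1 (hf' x))

/-- Bound for the proximity function of a difference quotient, with the zeros and poles in the
disk of twice the radius entering through their number. -/
theorem proximity_comp_add_const_div_le {f : ℂ → ℂ} {r E : ℝ} {c : ℂ} (hr : 4 ≤ r)
    (hf : Meromorphic f) (hf' : ∀ u, meromorphicOrderAt f u ≠ ⊤) (hc : ‖c‖ = 1)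
    (hE : ∀ a : ℂ, circleAverage (fun z ↦ Real.log (1 + ‖z - a‖⁻¹)) 0 r ≤ E) (s : Finset ℂ)
    (hs : (divisor f (ball 0 (2 * r))).support = s) :
    proximity (fun z ↦ f (z + c) / f z) ⊤ r
      ≤ 6 / r * (proximity f ⊤ (2 * r) + proximity f⁻¹ ⊤ (2 * r))
        + (∑ u ∈ s, |(divisor f (ball 0 (2 * r)) u : ℝ)|) * (3 / r + 2 * E) := by
  have hr0 : 0 < r := by linarith
  set D : ℂ → ℝ := fun u ↦ |(divisor f (ball 0 (2 * r)) u : ℝ)| with hD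
  set G : ℂ → ℂ → ℝ := fun u z ↦
    3 / r + (Real.log (1 + ‖z + c - u‖⁻¹) + Real.log (1 + ‖z - u‖⁻¹)) with hG
  set A : ℝ := 6 / r * circleAverage |(Real.log ‖f ·‖)| 0 (2 * r) with hA
  have hGint : ∀ u, CircleIntegrable (G u) 0 r ∧ circleAverage (G u) 0 r ≤ 3 / r + 2 * E := by
    intro u
    -- The shifted singularity is centred at u - c; uniformity of `E` in the centre covers it.
    have h1 := circleIntegrable_log_one_add_inv_norm_sub (u - c) r
    have h2 := hE (u - c)
    simp only [sub_sub_eq_add_sub] at h1 h2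
    have h3 := circleIntegrable_log_one_add_inv_norm_sub u r
    have h4 := circleIntegrable_const (3 / r) 0 r
    refine ⟨h4.add (h1.add h3), ?_⟩
    have h5 : circleAverage (G u) 0 r = circleAverage (fun _ ↦ 3 / r) 0 r
        + (circleAverage (fun z ↦ Real.log (1 + ‖z + c - u‖⁻¹)) 0 r
          + circleAverage (fun z ↦ Real.log (1 + ‖z - u‖⁻¹)) 0 r) := by
      rw [← circleAverage_add h1 h3, ← circleAverage_add h4 (h1.add h3)]
      rfl
    rw [h5, circleAverage_const]
    linarith [hE u]
  have hint : ∀ u ∈ s, CircleIntegrable (fun z ↦ D u • G u z) 0 r :=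
    fun u _ ↦ (hGint u).1.const_fun_smul
  have hsum : CircleIntegrable (fun z ↦ ∑ u ∈ s, D u • G u z) 0 r := CircleIntegrable.fun_sum _ hint
  have hq : Meromorphic fun z ↦ f (z + c) / f z := (hf.comp_add_const c).fun_div hf
  have hmono : circleAverage (fun z ↦ log⁺ ‖f (z + c) / f z‖) 0 r
      ≤ circleAverage (fun z ↦ A + ∑ u ∈ s, D u • G u z) 0 r := by
    refine circleAverage_mono_codiscrete hr0.ne' hq.meromorphicOn.circleIntegrable_posLog_norm
      ((circleIntegrable_const A _ _).add hsum) ?_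
    have h1 := hf.eventually_codiscrete_analyticAt_ne_zero hf'
    have h2 := h1.codiscrete_comp_add_const c
    filter_upwards [codiscreteWithin_mono (Set.subset_univ _) h1,
      codiscreteWithin_mono (Set.subset_univ _) h2,
      self_mem_codiscreteWithin (sphere (0 : ℂ) |r|)] with z hz₁ hz₂ hz₃
    rw [abs_of_pos hr0, mem_sphere_zero_iff_norm] at hz₃
    exact (posLog_norm_div_le hz₂.2 hz₁.2).trans
      (abs_log_norm_sub_log_norm_le hr rfl hf hf' hz₃ (by simpa using hc) hz₁.1 hz₁.2
        hz₂.1 hz₂.2 s hs)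
  rw [proximity_top]
  refine hmono.trans ?_
  rw [circleAverage_fun_add (circleIntegrable_const A _ _) hsum, circleAverage_const,
    circleAverage_fun_sum hint, hA, circleAverage_abs_log_norm hf, Finset.sum_mul]
  refine add_le_add le_rfl (Finset.sum_le_sum fun u _ ↦ ?_)
  rw [circleAverage_fun_smul, smul_eq_mul]
  exact mul_le_mul_of_nonneg_left (hGint u).2 (abs_nonneg _)

/-- The number of zeros and poles in a disk is controlled by the characteristic. -/
lemma sum_abs_divisor_mul_log_two_le {f : ℂ → ℂ} {ρ : ℝ} (hf : Meromorphic f) (hρ : 1 ≤ ρ)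
    (s : Finset ℂ) (hs : (divisor f (ball 0 ρ)).support = s) :
    (∑ u ∈ s, |(divisor f (ball 0 ρ) u : ℝ)|) * Real.log 2
      ≤ characteristic f ⊤ (2 * ρ) + characteristic f⁻¹ ⊤ (2 * ρ) := by
  have hmem : ∀ u ∈ s, u ∈ ball (0 : ℂ) ρ := by
    intro u hu
    have : u ∈ (divisor f (ball 0 ρ)).support := by rw [hs]; exact hu
    exact (divisor f (ball 0 ρ)).supportWithinDomain this
  have hnorm : ∀ u ∈ s, ‖u‖ ≤ ρ := fun u hu ↦ by
    have := hmem u hu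
    rw [mem_ball_zero_iff] at this
    exact this.le
  have h1 := sum_mul_log_two_le_logCounting (posPart_nonneg (divisor f Set.univ)) hρ s hnorm
  have h2 := sum_mul_log_two_le_logCounting (negPart_nonneg (divisor f Set.univ)) hρ s hnorm
  have h3 : ∑ u ∈ s, |(divisor f (ball 0 ρ) u : ℝ)|
      = ∑ u ∈ s, (((divisor f Set.univ)⁺ u : ℤ) : ℝ)
        + ∑ u ∈ s, (((divisor f Set.univ)⁻ u : ℤ) : ℝ) := by
    rw [← Finset.sum_add_distrib]
    refine Finset.sum_congr rfl fun u hu ↦ ?_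
    rw [divisor_apply hf.meromorphicOn (hmem u hu)]
    simp only [Function.locallyFinsuppWithin.posPart_apply,
      Function.locallyFinsuppWithin.negPart_apply, divisor_apply hf.meromorphicOn (Set.mem_univ u)]
    exact_mod_cast (posPart_add_negPart ((meromorphicOrderAt f u).untop₀)).symm
  rw [h3, add_mul]
  have h4 : logCounting f ⊤ (2 * ρ) ≤ characteristic f ⊤ (2 * ρ) :=
    le_add_of_nonneg_left (proximity_nonneg _)
  have h5 : logCounting f⁻¹ ⊤ (2 * ρ) ≤ characteristic f⁻¹ ⊤ (2 * ρ) :=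
    le_add_of_nonneg_left (proximity_nonneg _)
  rw [logCounting_inv, logCounting_zero] at h5
  rw [logCounting_top] at h4
  linarith

/-- **Lemma on the difference quotient**, in a weak form: the proximity function of
`f (z + c) / f z` is small compared to the characteristic of `f` on the circle of four times the
radius. -/
theorem eventually_proximity_comp_add_const_div_le {f : ℂ → ℂ} {c : ℂ} (hf : Meromorphic f)
    (hf' : ∀ u, meromorphicOrderAt f u ≠ ⊤) (hc : ‖c‖ = 1) {ε : ℝ} (hε : 0 < ε) :
    ∀ᶠ r in atTop, proximity (fun z ↦ f (z + c) / f z) ⊤ r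
      ≤ ε * (characteristic f ⊤ (4 * r) + 1) := by
  obtain ⟨η, hη, hηle⟩ := exists_tendsto_zero_circleAverage_log_one_add_inv_le
  obtain ⟨B, hB⟩ : ∃ B : ℝ, ∀ R, |characteristic f ⊤ R - characteristic f⁻¹ ⊤ R| ≤ B :=
    ⟨_, fun R ↦ characteristic_sub_characteristic_inv_le hf⟩
  have hB0 : 0 ≤ B := (abs_nonneg _).trans (hB 0)
  -- Both the proximity terms and, up to (log 2)⁻¹, the number of zeros and poles are at most 2T +
  -- B; κ collects their coefficients. As 2T + B ≤ (2 + B)(T + 1), it is enough that κ < ε/(2 + B).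
  set κ : ℝ → ℝ := fun r ↦ 6 / r + (Real.log 2)⁻¹ * (3 / r + 2 * η r) with hκ
  have hκlim : Tendsto κ atTop (𝓝 0) := by
    have h6 : Tendsto (fun r : ℝ ↦ 6 / r) atTop (𝓝 0) := tendsto_const_nhds.div_atTop tendsto_id
    have h3 : Tendsto (fun r : ℝ ↦ 3 / r) atTop (𝓝 0) := tendsto_const_nhds.div_atTop tendsto_id
    simpa using h6.add ((h3.add (hη.const_mul 2)).const_mul (Real.log 2)⁻¹)
  have hδ : 0 < ε / (2 + B) := by positivity
  filter_upwards [eventually_ge_atTop 4, hκlim.eventually_lt_const hδ] with r hr hκr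
  have hr0 : 0 < r := by linarith
  have hη0 : 0 ≤ η r := (circleAverage_nonneg_of_nonneg fun z _ ↦
    Real.log_nonneg (by simp)).trans (hηle r hr0 0)
  have hfin : (divisor f (ball 0 (2 * r))).support.Finite :=
    hf.meromorphicOn.divisor_ball_support_finite
  have hmain := proximity_comp_add_const_div_le hr hf hf' hc (hηle r hr0) hfin.toFinset (by simp)
  -- Poisson–Jensen uses the disk of radius 2r, and counting its points doubles the radius again:
  -- hence 4r.
  have hcount := sum_abs_divisor_mul_log_two_le (ρ := 2 * r) hf (by linarith) hfin.toFinset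
    (by simp)
  rw [← mul_assoc, show (2 : ℝ) * 2 = 4 by norm_num] at hcount
  set T := characteristic f ⊤ (4 * r) with hT
  set T' := characteristic f⁻¹ ⊤ (4 * r) with hT'
  have hT0 : 0 ≤ T := characteristic_nonneg (by linarith)
  have hTT' : T' ≤ T + B := by linarith [(abs_le.1 (hB (4 * r))).1]
  have hm : proximity f ⊤ (2 * r) ≤ T := by
    have h1 : proximity f ⊤ (2 * r) ≤ characteristic f ⊤ (2 * r) :=
      le_add_of_nonneg_right (logCounting_nonneg (by linarith))
    exact h1.trans (characteristic_monotoneOn hf (by simp; linarith) (by simp; linarith)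
      (by linarith))
  have hm' : proximity f⁻¹ ⊤ (2 * r) ≤ T' := by
    have h1 : proximity f⁻¹ ⊤ (2 * r) ≤ characteristic f⁻¹ ⊤ (2 * r) :=
      le_add_of_nonneg_right (logCounting_nonneg (by linarith))
    exact h1.trans (characteristic_monotoneOn hf.inv (by simp; linarith) (by simp; linarith)
      (by linarith))
  have hlog2 : 0 < Real.log 2 := Real.log_pos one_lt_two
  set S := ∑ u ∈ hfin.toFinset, |(divisor f (ball 0 (2 * r)) u : ℝ)| with hS
  have hS' : S ≤ (Real.log 2)⁻¹ * (2 * T + B) := by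
    rw [inv_mul_eq_div, le_div_iff₀ hlog2]
    linarith
  calc proximity (fun z ↦ f (z + c) / f z) ⊤ r
      ≤ 6 / r * (2 * T + B) + ((Real.log 2)⁻¹ * (2 * T + B)) * (3 / r + 2 * η r) := by
        refine hmain.trans (add_le_add ?_ ?_)
        · exact mul_le_mul_of_nonneg_left (by linarith) (by positivity)
        · exact mul_le_mul_of_nonneg_right hS' (by positivity)
    _ = κ r * (2 * T + B) := by rw [hκ]; ring
    _ ≤ ε / (2 + B) * (2 * T + B) := by gcongr
    _ ≤ ε / (2 + B) * ((2 + B) * (T + 1)) := by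
        gcongr
        nlinarith
    _ = ε * (T + 1) := by field_simp

end DifferenceQuotient

/-! ### Comparing counting functions of neighbouring points -/

section Counting

open Real Function.locallyFinsuppWithin Metric

/-- With x = ‖z‖, log (r/x) exceeds log ((r+1)/(x+1)) by at most (r-x)/((r+1)x), while the latter is
at least (r-x)/(r+1). The ratio is thus at most 1 + 1/x, and x > 1/ε. -/
lemma logCountingKernel_le_one_add_mul {ε : ℝ} (hε : 0 < ε) {r : ℝ} (hr : 1 ≤ r) {m z : ℂ}
    (hzm : ‖z - m‖ = 1) (hm : 2 + ε⁻¹ ≤ ‖m‖) :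
    logCountingKernel r z ≤ (1 + ε) * logCountingKernel (r + 1) m := by
  rcases lt_or_ge r ‖z‖ with h | h
  · rw [logCountingKernel_of_lt_norm hr h]
    exact mul_nonneg (by positivity) (logCountingKernel_nonneg (by linarith) m)
  have hεi : 0 < ε⁻¹ := inv_pos.2 hε
  have h1 : ‖m‖ ≤ ‖z‖ + 1 := by
    have := norm_sub_norm_le m z
    rw [norm_sub_rev, hzm] at this
    linarith
  have hx : ε⁻¹ < ‖z‖ := by linarith
  have hx0 : 0 < ‖z‖ := hεi.trans hx
  have hm0 : 0 < ‖m‖ := by linarith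
  rw [logCountingKernel_of_norm_le h (norm_pos_iff.1 hx0),
    logCountingKernel_of_norm_le (by linarith) (norm_pos_iff.1 hm0)]
  set x := ‖z‖ with hxdef
  have hr0 : 0 < r := by linarith
  have h2 : Real.log ((r + 1) / (x + 1)) ≤ Real.log ((r + 1) / ‖m‖) :=
    Real.log_le_log (by positivity) (by gcongr)
  have h3 : (r - x) / (r + 1) ≤ Real.log ((r + 1) / (x + 1)) := by
    have := Real.one_sub_inv_le_log_of_pos (x := (r + 1) / (x + 1)) (by positivity)
    rw [inv_div] at this
    refine le_trans (le_of_eq ?_) this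
    field_simp
    ring
  have h4 : Real.log (r / x) - Real.log ((r + 1) / (x + 1)) ≤ (r - x) / (r + 1) / x := by
    rw [← Real.log_div (by positivity) (by positivity)]
    refine (Real.log_le_sub_one_of_pos (by positivity)).trans (le_of_eq ?_)
    field_simp
    ring
  have h5 : (r - x) / (r + 1) / x ≤ (r - x) / (r + 1) * ε := by
    rw [div_eq_mul_inv _ x]
    refine mul_le_mul_of_nonneg_left ?_ (div_nonneg (by linarith) (by linarith))
    exact inv_le_of_inv_le₀ hε hx.le
  calc Real.log (r / x) ≤ (1 + ε) * Real.log ((r + 1) / (x + 1)) := by nlinarith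
    _ ≤ _ := by gcongr

/-- A crude bound for the points near the origin; what matters is that the error does not depend on
`r`. -/
lemma logCountingKernel_le_add {r : ℝ} (hr : 1 ≤ r) (m z : ℂ) :
    logCountingKernel r z ≤ logCountingKernel (r + 1) m + (log⁺ ‖z‖⁻¹ + log⁺ ‖m‖) := by
  have h1 : logCountingKernel r z ≤ Real.log r + log⁺ ‖z‖⁻¹ := by
    unfold logCountingKernel
    split_ifs
    · exact le_add_of_nonneg_right posLog_nonneg
    · rw [div_eq_mul_inv]
      refine posLog_mul.trans (le_of_eq ?_)
      rw [posLog_eq_log (x := r) (by rwa [abs_of_nonneg (by linarith)])]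
  have h2 : Real.log r ≤ logCountingKernel (r + 1) m + log⁺ ‖m‖ := by
    have h3 : Real.log r ≤ Real.log (r + 1) := Real.log_le_log (by linarith) (by linarith)
    unfold logCountingKernel
    split_ifs with hm
    · linarith [posLog_nonneg (x := ‖m‖)]
    · have hm0 : ‖m‖ ≠ 0 := norm_ne_zero_iff.2 hm
      calc Real.log r ≤ Real.log (r + 1) := h3
        _ ≤ log⁺ (r + 1) := le_max_right _ _
        _ = log⁺ ((r + 1) / ‖m‖ * ‖m‖) := by rw [div_mul_cancel₀ _ hm0]
        _ ≤ _ := posLog_mul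
  linarith

/-- If every point of the divisors `A` and `B` is dominated by the two neighbouring points of the
divisor `P`, and each point of `P` has neighbours of total weight at most two, where points of `A`
have weight one and points of `B` have weight two, then the counting functions compare. -/
theorem exists_logCounting_add_two_mul_le {A B P : Function.locallyFinsupp ℂ ℤ}
    (hP₀ : 0 ≤ P) (hA : ∀ z, A z ≤ P (z + 1) + P (z - 1))
    (hB : ∀ z, B z ≤ P (z + 1) + P (z - 1)) (α : ℂ → ℝ) (hα₀ : ∀ z, 0 ≤ α z)
    (hαAB : ∀ z, A z ≠ 0 → B z ≠ 0 → 3 ≤ α z) (hαA : ∀ z, A z ≠ 0 → 1 ≤ α z)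
    (hαB : ∀ z, B z ≠ 0 → 2 ≤ α z) (hα : ∀ m, P m ≠ 0 → α (m + 1) + α (m - 1) ≤ 2)
    {ε : ℝ} (hε : 0 < ε) :
    ∃ K : ℝ, ∀ r ≥ 1, logCounting A r + 2 * logCounting B r
      ≤ 2 * (1 + ε) * logCounting P (r + 1) + K := by
  classical
  have hPr : ∀ z, (0 : ℝ) ≤ P z := fun z ↦ by exact_mod_cast hP₀ z
  set M : ℝ := 2 + ε⁻¹ with hM
  -- The additive error vanishes far out, so only finitely many points of `P` contribute to `K`.
  set h : ℂ → ℝ := fun m ↦ if M ≤ ‖m‖ then 0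
    else log⁺ ‖m + 1‖⁻¹ + log⁺ ‖m - 1‖⁻¹ + log⁺ ‖m‖ with hh
  have hh0 : ∀ m, 0 ≤ h m := by
    intro m
    simp only [hh]
    split_ifs
    · exact le_rfl
    · exact add_nonneg (add_nonneg posLog_nonneg posLog_nonneg) posLog_nonneg
  set u : Finset ℂ := (finite_support_inter_closedBall P M).toFinset with hu
  refine ⟨2 * ∑ m ∈ u, (P m : ℝ) * h m, fun r hr ↦ ?_⟩
  set g := logCountingKernel r with hg
  set G := logCountingKernel (r + 1) with hG
  have hg0 : ∀ z, 0 ≤ g z := logCountingKernel_nonneg hr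
  have hG0 : ∀ z, 0 ≤ G z := logCountingKernel_nonneg (by linarith)
  have hgG : ∀ m, g (m + 1) ≤ (1 + ε) * G m + h m ∧ g (m - 1) ≤ (1 + ε) * G m + h m := by
    intro m
    simp only [hh]
    split_ifs with hm
    · rw [add_zero]
      exact ⟨logCountingKernel_le_one_add_mul hε hr (by simp) hm,
        logCountingKernel_le_one_add_mul hε hr (by simp) hm⟩
    · have h1 := logCountingKernel_le_add hr m (m + 1)
      have h2 := logCountingKernel_le_add hr m (m - 1)
      have h3 : 0 ≤ log⁺ ‖m + 1‖⁻¹ := posLog_nonneg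
      have h4 : 0 ≤ log⁺ ‖m - 1‖⁻¹ := posLog_nonneg
      have h5 : 0 ≤ ε * G m := mul_nonneg hε.le (hG0 m)
      constructor <;> linarith
  set s : Finset ℂ := (finite_support_inter_closedBall A r).toFinset
    ∪ (finite_support_inter_closedBall B r).toFinset with hs
  set t : Finset ℂ := (finite_support_inter_closedBall P (r + 1)).toFinset
    ∪ (s.map (Equiv.addRight (1 : ℂ)).toEmbedding ∪ s.map (Equiv.subRight (1 : ℂ)).toEmbedding)
    with ht
  have hpt : ∀ z, (A z : ℝ) + 2 * B z ≤ α z * (P (z + 1) + P (z - 1)) := by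
    intro z
    have a1 : (A z : ℝ) ≤ P (z + 1) + P (z - 1) := by exact_mod_cast hA z
    have b1 : (B z : ℝ) ≤ P (z + 1) + P (z - 1) := by exact_mod_cast hB z
    have p1 : (0 : ℝ) ≤ P (z + 1) + P (z - 1) := add_nonneg (hPr _) (hPr _)
    by_cases hAz : A z = 0 <;> by_cases hBz : B z = 0
    · simp only [hAz, hBz, Int.cast_zero, mul_zero, add_zero]
      exact mul_nonneg (hα₀ z) p1
    · have := mul_le_mul_of_nonneg_right (hαB z hBz) p1
      simp only [hAz, Int.cast_zero, zero_add]
      linarith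
    · have := mul_le_mul_of_nonneg_right (hαA z hAz) p1
      simp only [hBz, Int.cast_zero, mul_zero, add_zero]
      linarith
    · have := mul_le_mul_of_nonneg_right (hαAB z hAz hBz) p1
      linarith
  calc logCounting A r + 2 * logCounting B r
      = ∑ z ∈ s, ((A z : ℝ) + 2 * B z) * g z := by
        rw [logCounting_eq_sum_logCountingKernel A hr s (fun z h1 h2 ↦ by simp [hs, h1, h2]),
          logCounting_eq_sum_logCountingKernel B hr s (fun z h1 h2 ↦ by simp [hs, h1, h2]),
          Finset.mul_sum, ← Finset.sum_add_distrib]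
        exact Finset.sum_congr rfl fun z _ ↦ by ring
    _ ≤ ∑ z ∈ s, (α z * P (z + 1) * g z + α z * P (z - 1) * g z) := by
        refine Finset.sum_le_sum fun z _ ↦ ?_
        have := mul_le_mul_of_nonneg_right (hpt z) (hg0 z)
        linarith
    -- Double counting: the sum is reindexed by the dominating point `m` of `P`, where the weights
    -- of its two neighbours can be added.
    _ = ∑ m ∈ s.map (Equiv.addRight (1 : ℂ)).toEmbedding, α (m - 1) * P m * g (m - 1)
        + ∑ m ∈ s.map (Equiv.subRight (1 : ℂ)).toEmbedding, α (m + 1) * P m * g (m + 1) := by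
        rw [Finset.sum_add_distrib, Finset.sum_map, Finset.sum_map]
        simp
    _ ≤ ∑ m ∈ t, α (m - 1) * P m * g (m - 1) + ∑ m ∈ t, α (m + 1) * P m * g (m + 1) := by
        refine add_le_add ?_ ?_
        · refine Finset.sum_le_sum_of_subset_of_nonneg ?_ fun m _ _ ↦
            mul_nonneg (mul_nonneg (hα₀ _) (hPr m)) (hg0 _)
          exact Finset.subset_union_left.trans Finset.subset_union_right
        · refine Finset.sum_le_sum_of_subset_of_nonneg ?_ fun m _ _ ↦
            mul_nonneg (mul_nonneg (hα₀ _) (hPr m)) (hg0 _)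
          exact Finset.subset_union_right.trans Finset.subset_union_right
    _ ≤ ∑ m ∈ t, (2 * (1 + ε) * (P m * G m) + 2 * (P m * h m)) := by
        rw [← Finset.sum_add_distrib]
        refine Finset.sum_le_sum fun m _ ↦ ?_
        by_cases hm : P m = 0
        · simp [hm]
        have h1 := hα m hm
        have h2 : 0 ≤ (1 + ε) * G m + h m := add_nonneg (mul_nonneg (by positivity) (hG0 m)) (hh0 m)
        have h3 := mul_le_mul_of_nonneg_left (hgG m).1 (hα₀ (m + 1))
        have h4 := mul_le_mul_of_nonneg_left (hgG m).2 (hα₀ (m - 1))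
        have h5 := mul_le_mul_of_nonneg_right h1 h2
        have h6 : α (m - 1) * g (m - 1) + α (m + 1) * g (m + 1) ≤ 2 * ((1 + ε) * G m + h m) := by
          linarith
        have h7 := mul_le_mul_of_nonneg_left h6 (hPr m)
        linarith
    _ = 2 * (1 + ε) * logCounting P (r + 1) + 2 * ∑ m ∈ t, (P m : ℝ) * h m := by
        rw [logCounting_eq_sum_logCountingKernel P (by linarith) t
          (fun z h1 h2 ↦ by simp [ht, h1, h2]), Finset.sum_add_distrib, Finset.mul_sum,
          Finset.mul_sum]
    _ ≤ _ := by
        have h1 : ∑ m ∈ t, (P m : ℝ) * h m ≤ ∑ m ∈ t ∪ u, (P m : ℝ) * h m :=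
          Finset.sum_le_sum_of_subset_of_nonneg Finset.subset_union_left fun m _ _ ↦
            mul_nonneg (hPr m) (hh0 m)
        have h2 : ∑ m ∈ u, (P m : ℝ) * h m = ∑ m ∈ t ∪ u, (P m : ℝ) * h m := by
          refine Finset.sum_subset Finset.subset_union_right fun m _ hm ↦ ?_
          simp only [hu, Set.Finite.mem_toFinset, Set.mem_ofPred_eq, not_and, not_le] at hm
          by_cases hP : P m = 0
          · simp [hP]
          · simp [hh, (hm hP).le]
        linarith

end Counting

/-! ### Local analysis of the equation at ±1-points and poles -/

section Equation

open Topology MeromorphicOn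

lemma one_sub_sq_eq {t x : ℂ} (ht : t ^ 2 = 1) : 1 - x ^ 2 = -((x - t) * (x + t)) := by
  linear_combination -ht

lemma untop₀_nonpos {o : WithTop ℤ} (ho : o ≤ 0) : o.untop₀ ≤ 0 := by
  lift o to ℤ using (ho.trans_lt (WithTop.coe_lt_top 0)).ne
  exact_mod_cast ho

/-- At a zero of `w - t`, `t = ±1`, one of the neighbouring points is a pole of `w` of at least the
same order. -/
lemma posPart_divisor_sub_const_le {a₀ a₂ t : ℂ} {w : ℂ → ℂ} (hw : Meromorphic w)
    (ht : t ^ 2 = 1) (ha : a₂ + a₀ ≠ 0)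
    (heq : ∀ᶠ z in codiscrete ℂ, w (z + 1) + w (z - 1) = (a₂ * w z ^ 2 + a₀) / (1 - w z ^ 2))
    (htop : ∀ u, meromorphicOrderAt (fun z ↦ w z - t) u ≠ ⊤) (x : ℂ) :
    (divisor (fun z ↦ w z - t) Set.univ)⁺ x
      ≤ (divisor w Set.univ)⁻ (x + 1) + (divisor w Set.univ)⁻ (x - 1) := by
  have hm : Meromorphic fun z ↦ w z - t := hw.fun_sub (Meromorphic.const t)
  have hm' : Meromorphic fun z ↦ w z + t := hw.fun_add (Meromorphic.const t)
  simp only [Function.locallyFinsuppWithin.posPart_apply,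
    Function.locallyFinsuppWithin.negPart_apply, divisor_apply hw.meromorphicOn (Set.mem_univ _),
    divisor_apply hm.meromorphicOn (Set.mem_univ _)]
  rcases le_or_gt (meromorphicOrderAt (fun z ↦ w z - t) x) 0 with hk | hk
  · have : (meromorphicOrderAt (fun z ↦ w z - t) x).untop₀⁺ = 0 := by
      rw [posPart_eq_zero]
      exact untop₀_nonpos hk
    rw [this]
    exact add_nonneg (negPart_nonneg _) (negPart_nonneg _)
  have ht0 : t ≠ 0 := by
    rintro rfl
    norm_num at ht
  have hlim : Tendsto w (𝓝[≠] x) (𝓝 t) := by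
    have := (tendsto_zero_of_meromorphicOrderAt_pos hk).add_const t
    simpa using this
  have ord1 : meromorphicOrderAt (fun z ↦ w z + t) x = 0 := by
    refine (tendsto_ne_zero_iff_meromorphicOrderAt_eq_zero (hm' x)).1 ⟨t + t, ?_, hlim.add_const t⟩
    rw [← two_mul]
    exact mul_ne_zero two_ne_zero ht0
  have hnum : Meromorphic fun z ↦ a₂ * w z ^ 2 + a₀ := by fun_prop
  have ord2 : meromorphicOrderAt (fun z ↦ a₂ * w z ^ 2 + a₀) x = 0 := by
    refine (tendsto_ne_zero_iff_meromorphicOrderAt_eq_zero (hnum x)).1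
      ⟨a₂ * t ^ 2 + a₀, ?_, ((hlim.pow 2).const_mul a₂).add_const a₀⟩
    rwa [ht, mul_one]
  have hF : Meromorphic fun z ↦ w (z + 1) + w (z + -1) :=
    (hw.comp_add_const 1).fun_add (hw.comp_add_const (-1))
  -- The equation reads (w - t)(w + t)(w(z+1) + w(z-1)) = -(a₂w² + a₀). Since w + t and the
  -- numerator have the nonzero limits 2t and a₂ + a₀, the other two orders cancel.
  have key : meromorphicOrderAt (fun z ↦ w z - t) x
      + meromorphicOrderAt (fun z ↦ w (z + 1) + w (z + -1)) x = 0 := by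
    calc _ = meromorphicOrderAt (fun z ↦ (w z - t) * (w z + t) * (w (z + 1) + w (z + -1))) x := by
          rw [fun_meromorphicOrderAt_mul ((hm.fun_mul hm') x) (hF x),
            fun_meromorphicOrderAt_mul (hm x) (hm' x), ord1, add_zero]
      _ = meromorphicOrderAt (fun z ↦ -(a₂ * w z ^ 2 + a₀)) x := by
          refine meromorphicOrderAt_congr ?_
          have hne1 := (meromorphicOrderAt_ne_top_iff_eventually_ne_zero (hm x)).1 (htop x)
          have hne2 := (meromorphicOrderAt_ne_top_iff_eventually_ne_zero (hm' x)).1 (by simp [ord1])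
          filter_upwards [eventually_codiscrete_iff.1 heq x, hne1, hne2] with z hz h1 h2
          rw [← sub_eq_add_neg, hz, one_sub_sq_eq ht]
          field_simp
      _ = 0 := by rw [← meromorphicOrderAt_fun_neg, ord2]
  -- The order of a sum is at least the smaller order, so one neighbour has order at most -k.
  have hadd := meromorphicOrderAt_add ((hw.comp_add_const 1) x) ((hw.comp_add_const (-1)) x)
  simp only [meromorphicOrderAt_fun_comp_add_const_eq_meromorphicOrderAt] at hadd
  change _ ≤ meromorphicOrderAt (fun z ↦ w (z + 1) + w (z + -1)) x at hadd
  rw [← sub_eq_add_neg] at hadd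
  have hFtop : meromorphicOrderAt (fun z ↦ w (z + 1) + w (z + -1)) x ≠ ⊤ := by
    intro h
    simp [h] at key
  lift meromorphicOrderAt (fun z ↦ w z - t) x to ℤ using htop x with k
  lift meromorphicOrderAt (fun z ↦ w (z + 1) + w (z + -1)) x to ℤ using hFtop with l
  have hkl : k + l = 0 := by exact_mod_cast key
  have hk0 : 0 < k := by exact_mod_cast hk
  have neg : ∀ {o : WithTop ℤ}, o ≤ (l : WithTop ℤ) → k ≤ o.untop₀⁻ := by
    intro o ho
    lift o to ℤ using (ho.trans_lt (WithTop.coe_lt_top l)).ne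
    have : o ≤ l := by exact_mod_cast ho
    rw [WithTop.untop₀_coe, negPart_def]
    exact le_max_of_le_left (by omega)
  rw [WithTop.untop₀_coe, posPart_of_nonneg hk0.le]
  rcases min_le_iff.1 hadd with h | h
  · exact (neg h).trans (le_add_of_nonneg_right (negPart_nonneg _))
  · exact (neg h).trans (le_add_of_nonneg_left (negPart_nonneg _))

/-- Limits of `w` at the two neighbours of a pole of `w` sum up to `-a₂`. -/
lemma add_eq_neg_of_tendsto {a₀ a₂ s t : ℂ} {w : ℂ → ℂ}
    (heq : ∀ᶠ z in codiscrete ℂ, w (z + 1) + w (z - 1) = (a₂ * w z ^ 2 + a₀) / (1 - w z ^ 2))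
    {m : ℂ} (hm : meromorphicOrderAt w m < 0) (hs : Tendsto w (𝓝[≠] (m + 1)) (𝓝 s))
    (ht : Tendsto w (𝓝[≠] (m - 1)) (𝓝 t)) : s + t = -a₂ := by
  have hcob := tendsto_cobounded_of_meromorphicOrderAt_neg hm
  have hinv : Tendsto (fun z ↦ (w z)⁻¹) (𝓝[≠] m) (𝓝 0) := tendsto_inv₀_cobounded.comp hcob
  have hne : ∀ᶠ z in 𝓝[≠] m, w z ≠ 0 := hcob.eventually_ne_cobounded 0
  have h1 : Tendsto (fun z ↦ w (z + 1) + w (z - 1)) (𝓝[≠] m) (𝓝 (s + t)) := by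
    refine (hs.comp (tendsto_add_const_nhdsNE 1 m)).add ?_
    have := tendsto_add_const_nhdsNE (-1) m
    simp only [← sub_eq_add_neg] at this
    exact ht.comp this
  have h2 : Tendsto (fun z ↦ (a₂ + a₀ * (w z)⁻¹ ^ 2) / ((w z)⁻¹ ^ 2 - 1)) (𝓝[≠] m) (𝓝 (-a₂)) := by
    have := (((hinv.pow 2).const_mul a₀).const_add a₂).div ((hinv.pow 2).sub_const 1) (by norm_num)
    simpa [div_neg, Pi.div_def] using this
  refine tendsto_nhds_unique (h1.congr' ?_) h2
  filter_upwards [eventually_codiscrete_iff.1 heq m, hne] with z hz h0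
  rw [hz, ← mul_div_mul_left (a₂ + a₀ * (w z)⁻¹ ^ 2) _ (pow_ne_zero 2 h0)]
  congr 1 <;> field_simp

lemma tendsto_of_posPart_divisor_sub_const_ne_zero {w : ℂ → ℂ} {t x : ℂ}
    (h : (divisor (fun z ↦ w z - t) Set.univ)⁺ x ≠ 0) : Tendsto w (𝓝[≠] x) (𝓝 t) := by
  have hpos : 0 < meromorphicOrderAt (fun z ↦ w z - t) x := by
    by_contra hle
    apply h
    rw [Function.locallyFinsuppWithin.posPart_apply, posPart_eq_zero, divisor_def]
    split_ifs
    · exact untop₀_nonpos (not_lt.1 hle)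
    · exact le_rfl
  simpa using (tendsto_zero_of_meromorphicOrderAt_pos hpos).add_const t

lemma meromorphicOrderAt_neg_of_negPart_divisor_ne_zero {w : ℂ → ℂ} {x : ℂ}
    (h : (divisor w Set.univ)⁻ x ≠ 0) : meromorphicOrderAt w x < 0 := by
  by_contra hle
  apply h
  rw [Function.locallyFinsuppWithin.negPart_apply, negPart_eq_zero, divisor_def]
  split_ifs
  · rw [not_lt] at hle
    rw [WithTop.untop₀_nonneg]
    exact hle
  · exact le_rfl

/-- Comparison of the counting functions of the `±1`-points with that of the poles. -/
theorem exists_logCounting_sub_add_two_mul_le {a₀ a₂ s : ℂ} {w : ℂ → ℂ} (hw : Meromorphic w)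
    (hs : s ^ 2 = 1) (ha : a₂ + a₀ ≠ 0) (ha₂ : a₂ ≠ 0) (has : a₂ ≠ 2 * s)
    (heq : ∀ᶠ z in codiscrete ℂ, w (z + 1) + w (z - 1) = (a₂ * w z ^ 2 + a₀) / (1 - w z ^ 2))
    (htop : ∀ t u, meromorphicOrderAt (fun z ↦ w z - t) u ≠ ⊤) {ε : ℝ} (hε : 0 < ε) :
    ∃ K : ℝ, ∀ r ≥ 1, ValueDistribution.logCounting w s r
      + 2 * ValueDistribution.logCounting w (-s : ℂ) r
      ≤ 2 * (1 + ε) * ValueDistribution.logCounting w ⊤ (r + 1) + K := by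
  classical
  rw [ValueDistribution.logCounting_coe, ValueDistribution.logCounting_coe,
    ValueDistribution.logCounting_top]
  have hs0 : s ≠ 0 := by
    rintro rfl
    norm_num at hs
  set A := (divisor (fun z ↦ w z - s) Set.univ)⁺ with hA
  set B := (divisor (fun z ↦ w z - -s) Set.univ)⁺ with hB
  have tA : ∀ {x}, A x ≠ 0 → Tendsto w (𝓝[≠] x) (𝓝 s) :=
    tendsto_of_posPart_divisor_sub_const_ne_zero
  have tB : ∀ {x}, B x ≠ 0 → Tendsto w (𝓝[≠] x) (𝓝 (-s)) :=
    tendsto_of_posPart_divisor_sub_const_ne_zero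
  have hAB : ∀ {x}, A x ≠ 0 → B x = 0 := by
    intro x h1
    by_contra h2
    exact self_ne_neg.2 hs0 (tendsto_nhds_unique (tA h1) (tB h2))
  refine exists_logCounting_add_two_mul_le (negPart_nonneg _)
    (posPart_divisor_sub_const_le hw hs ha heq (htop s))
    (posPart_divisor_sub_const_le hw (by rw [neg_sq, hs]) ha heq (htop (-s)))
    (fun z ↦ (if A z ≠ 0 then 1 else 0) + (if B z ≠ 0 then 2 else 0)) ?_ ?_ ?_ ?_ ?_ hε
  · intro z
    positivity
  · intro z h1 h2
    exact absurd (hAB h1) h2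
  · intro z h1
    rw [if_pos h1]
    split_ifs <;> norm_num
  · intro z h1
    rw [if_pos h1]
    split_ifs <;> norm_num
  · intro m hm
    have hlim := fun {x y : ℂ} (h1 : Tendsto w (𝓝[≠] (m + 1)) (𝓝 x)) h2 ↦
      add_eq_neg_of_tendsto (t := y) heq (meromorphicOrderAt_neg_of_negPart_divisor_ne_zero hm) h1 h2
    -- Neighbours s and -s would give a₂ = 0, and -s twice would give a₂ = 2s. The surviving
    -- configurations, such as s twice or a single -s, have weight at most 2.
    by_cases h1 : A (m + 1) = 0 <;> by_cases h2 : B (m + 1) = 0 <;>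
      by_cases h3 : A (m - 1) = 0 <;> by_cases h4 : B (m - 1) = 0
    all_goals first
      | exact absurd (hAB h1) h2
      | exact absurd (hAB h3) h4
      | (simp only [h1, h2, h3, h4, ne_eq, not_false_eq_true, not_true_eq_false, if_true, if_false]
         norm_num
         done)
      | (exfalso
         first
         | (have h := hlim (tA h1) (tB h4); apply ha₂; linear_combination h)
         | (have h := hlim (tB h2) (tA h3); apply ha₂; linear_combination h)
         | (have h := hlim (tB h2) (tB h4); apply has; linear_combination h))

end Equation

/-! ### Proximity to the values ±1 -/

section ProximityEstimate

open Topology MeromorphicOn ValueDistribution Real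

/-- Pointwise form of the estimate for the proximity to the zeros `t = ±1` of the denominator. -/
lemma posLog_norm_inv_sub_le {a₀ a₂ t x p q : ℂ} (ht : t ^ 2 = 1) (ha : a₂ + a₀ ≠ 0)
    (h : p + q = (a₂ * x ^ 2 + a₀) / (1 - x ^ 2)) :
    log⁺ ‖(x - t)⁻¹‖ ≤ log⁺ ‖(p - t) / (x - t)‖ + log⁺ ‖(q - t) / (x - t)‖
      + log⁺ (3 * (4 + ‖a₂‖) / ‖a₂ + a₀‖) := by
  rcases le_or_gt 1 ‖x - t‖ with hv | hv
  · have : log⁺ ‖(x - t)⁻¹‖ = 0 := by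
      rw [posLog_eq_zero_iff, abs_norm, norm_inv]
      exact inv_le_one_of_one_le₀ hv
    rw [this]
    exact add_nonneg (add_nonneg posLog_nonneg posLog_nonneg) posLog_nonneg
  -- Here the convention 0⁻¹ = 0 makes the left side zero.
  rcases eq_or_ne (x - t) 0 with h0 | h0
  · rw [h0, inv_zero, norm_zero, posLog_zero]
    exact add_nonneg (add_nonneg posLog_nonneg posLog_nonneg) posLog_nonneg
  have htn : ‖t‖ = 1 := by
    have : ‖t‖ ^ 2 = 1 := by rw [← norm_pow, ht, norm_one]
    exact (pow_eq_one_iff_of_nonneg (norm_nonneg t) two_ne_zero).1 this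
  have h2t : ‖2 * t‖ = 2 := by rw [norm_mul, htn]; norm_num
  have hxt : x + t = (x - t) + 2 * t := by ring
  have hxt0 : x + t ≠ 0 := by
    intro h1
    rw [hxt, add_eq_zero_iff_eq_neg] at h1
    rw [h1, norm_neg, h2t] at hv
    norm_num at hv
  have hxt3 : ‖x + t‖ ≤ 3 := by
    rw [hxt]
    exact (norm_add_le _ _).trans (by linarith)
  rw [one_sub_sq_eq ht, eq_div_iff (neg_ne_zero.2 (mul_ne_zero h0 hxt0))] at h
  -- From a₂x² + a₀ = a₂(x² - 1) + (a₂ + a₀) and p + q = (p - t) + (q - t) + 2t.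
  have key : (a₂ + a₀) * (x - t)⁻¹ = -(((p - t) / (x - t) * (x - t) + (q - t) / (x - t) * (x - t)
      + 2 * t + a₂) * (x + t)) := by
    rw [div_mul_cancel₀ _ h0, div_mul_cancel₀ _ h0, ← div_eq_mul_inv, div_eq_iff h0]
    linear_combination -h - a₂ * ht
  set α := ‖(p - t) / (x - t)‖ with hα
  set β := ‖(q - t) / (x - t)‖ with hβ
  have hα0 : 0 ≤ α := norm_nonneg _
  have hβ0 : 0 ≤ β := norm_nonneg _
  have han : 0 < ‖a₂ + a₀‖ := norm_pos_iff.2 ha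
  have hb : ‖(p - t) / (x - t) * (x - t) + (q - t) / (x - t) * (x - t) + 2 * t + a₂‖
      ≤ α + β + 2 + ‖a₂‖ := by
    refine (norm_add_le _ _).trans (add_le_add_left ?_ _)
    refine (norm_add_le _ _).trans (add_le_add ?_ h2t.le)
    refine (norm_add_le _ _).trans (add_le_add ?_ ?_) <;> rw [norm_mul]
    · exact mul_le_of_le_one_right hα0 hv.le
    · exact mul_le_of_le_one_right hβ0 hv.le
  have hbd : ‖(x - t)⁻¹‖ ≤ max 1 α * max 1 β * (3 * (4 + ‖a₂‖) / ‖a₂ + a₀‖) := by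
    have h1 := congrArg norm key
    rw [norm_mul, norm_neg, norm_mul] at h1
    rw [← mul_div_assoc, le_div_iff₀ han, mul_comm _ ‖a₂ + a₀‖, h1]
    have h2 : α + β + 2 + ‖a₂‖ ≤ max 1 α * max 1 β * (4 + ‖a₂‖) := by
      have e1 : 1 ≤ max 1 α := le_max_left _ _
      have e2 : 1 ≤ max 1 β := le_max_left _ _
      have e3 : α ≤ max 1 α := le_max_right _ _
      have e4 : β ≤ max 1 β := le_max_right _ _
      have e5 : max 1 α ≤ max 1 α * max 1 β := le_mul_of_one_le_right (by positivity) e2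
      have e6 : max 1 β ≤ max 1 α * max 1 β := le_mul_of_one_le_left (by positivity) e1
      nlinarith [norm_nonneg a₂]
    calc _ ≤ (max 1 α * max 1 β * (4 + ‖a₂‖)) * 3 :=
          mul_le_mul (hb.trans h2) hxt3 (norm_nonneg _) (by positivity)
      _ = _ := by ring
  have hmax : ∀ {y : ℝ}, 0 ≤ y → log⁺ (max 1 y) = log⁺ y := by
    intro y hy
    rcases le_total 1 y with h1 | h1
    · rw [max_eq_right h1]
    · rw [max_eq_left h1, (posLog_eq_zero_iff y).2 (by rwa [abs_of_nonneg hy]), posLog_one]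
  calc _ ≤ log⁺ (max 1 α * max 1 β * (3 * (4 + ‖a₂‖) / ‖a₂ + a₀‖)) :=
        posLog_le_posLog (norm_nonneg _) hbd
    _ ≤ _ := posLog_mul.trans (add_le_add_left posLog_mul _)
    _ = _ := by rw [hmax hα0, hmax hβ0]

/-- The characteristic is, up to a small error, the counting function of the `t`-points, for
`t = ±1`. -/
theorem exists_eventually_characteristic_le_logCounting_add {a₀ a₂ t : ℂ} {w : ℂ → ℂ}
    (hw : Meromorphic w) (ht : t ^ 2 = 1) (ha : a₂ + a₀ ≠ 0)
    (heq : ∀ᶠ z in codiscrete ℂ, w (z + 1) + w (z - 1) = (a₂ * w z ^ 2 + a₀) / (1 - w z ^ 2))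
    (htop : ∀ u, meromorphicOrderAt (fun z ↦ w z - t) u ≠ ⊤) {ε : ℝ} (hε : 0 < ε) :
    ∃ K : ℝ, ∀ᶠ r in atTop, characteristic w ⊤ r
      ≤ logCounting w t r + ε * characteristic w ⊤ (4 * r) + K := by
  set v : ℂ → ℂ := fun z ↦ w z - t with hv
  have hvm : Meromorphic v := hw.fun_sub (Meromorphic.const t)
  set L := log⁺ (3 * (4 + ‖a₂‖) / ‖a₂ + a₀‖) with hL
  have hq : ∀ c, Meromorphic fun z ↦ v (z + c) / v z := fun c ↦
    (hvm.comp_add_const c).fun_div hvm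
  have hprox : ∀ r ≠ 0, proximity v⁻¹ ⊤ r ≤ proximity (fun z ↦ v (z + 1) / v z) ⊤ r
      + proximity (fun z ↦ v (z + -1) / v z) ⊤ r + L := by
    intro r hr
    have i1 := (hq 1).meromorphicOn.circleIntegrable_posLog_norm (c := 0) (R := r)
    have i2 := (hq (-1)).meromorphicOn.circleIntegrable_posLog_norm (c := 0) (R := r)
    have i3 : CircleIntegrable (fun _ : ℂ ↦ L) 0 r := circleIntegrable_const L _ _
    rw [proximity_top, proximity_top, proximity_top]
    have hconst : Real.circleAverage (fun _ : ℂ ↦ L) 0 r = L := circleAverage_const _ _ _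
    rw [← hconst, ← circleAverage_add i1 i2, ← circleAverage_add (i1.add i2) i3]
    refine circleAverage_mono_codiscrete hr
      hvm.inv.meromorphicOn.circleIntegrable_posLog_norm ((i1.add i2).add i3) ?_
    filter_upwards [heq.filter_mono (codiscreteWithin_mono (Set.subset_univ _))] with z hz
    rw [sub_eq_add_neg z 1] at hz
    exact posLog_norm_inv_sub_le ht ha hz
  -- `B` is the cost of passing from `v` to its inverse, `D` that of passing from `w` to w - t;
  -- neither depends on `r`.
  set B := max |Real.log ‖v 0‖| |Real.log ‖meromorphicTrailingCoeffAt v 0‖| with hB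
  set D := log⁺ ‖t‖ + Real.log 2 with hD
  have hε' : 0 < ε / 2 := half_pos hε
  refine ⟨D + B + L + ε * (D + 1), ?_⟩
  filter_upwards [eventually_proximity_comp_add_const_div_le hvm htop norm_one hε',
    eventually_proximity_comp_add_const_div_le (c := -1) hvm htop (by simp) hε',
    eventually_gt_atTop 0] with r h1 h2 hr
  have h3 := hprox r hr.ne'
  have h4 := abs_le.1 (characteristic_sub_characteristic_inv_le hvm (R := r))
  have h5 := abs_le.1 (abs_characteristic_sub_characteristic_shift_le hw (a₀ := t) (r := r))
  have h6 := abs_le.1 (abs_characteristic_sub_characteristic_shift_le hw (a₀ := t) (r := 4 * r))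
  have h7 : characteristic v⁻¹ ⊤ r = proximity v⁻¹ ⊤ r + logCounting w t r := by
    rw [characteristic, Pi.add_apply, logCounting_inv, logCounting_coe_eq_logCounting_sub_const_zero]
    rfl
  have h8 : ε * characteristic v ⊤ (4 * r) ≤ ε * (characteristic w ⊤ (4 * r) + D) :=
    mul_le_mul_of_nonneg_left (by linarith [h6.1]) hε.le
  linarith [h4.2, h5.2]

end ProximityEstimate

/-! ### Growth of the characteristic -/

section Growth

open Topology

/-- A function of polynomial growth does not grow fast along all geometric progressions. -/
lemma frequently_comp_eight_mul_le {T : ℝ → ℝ} (hT : Tendsto T atTop atTop) {n : ℕ}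
    (hn : ∀ᶠ r in atTop, T r ≤ r ^ n) : ∃ᶠ r in atTop, T (8 * r) ≤ 8 ^ (n + 1) * T r := by
  intro hev
  simp only [not_le] at hev
  obtain ⟨R, hR⟩ := eventually_atTop.1
    (hev.and (hn.and ((hT.eventually_ge_atTop 1).and (eventually_ge_atTop 1))))
  have hR1 : 1 ≤ R := (hR R le_rfl).2.2.2
  have hpow : ∀ k : ℕ, R ≤ 8 ^ k * R := fun k ↦
    le_mul_of_one_le_left (by linarith) (one_le_pow₀ (by norm_num))
  -- If the inequality failed from `R` on, T(8^k R) would be at least 8^((n+1)k), against the bound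
  -- (8^k R)^n as soon as 8^k > R^n.
  have hgrow : ∀ k : ℕ, ((8 : ℝ) ^ (n + 1)) ^ k ≤ T (8 ^ k * R) := by
    intro k
    induction k with
    | zero => simpa using (hR R le_rfl).2.2.1
    | succ k ih =>
      have h1 := (hR _ (hpow k)).1
      rw [← mul_assoc, ← pow_succ'] at h1
      refine le_trans ?_ h1.le
      rw [pow_succ' _ k]
      gcongr
  obtain ⟨k, hk⟩ := pow_unbounded_of_one_lt (R ^ n) (show (1 : ℝ) < 8 by norm_num)
  have h1 := (hgrow k).trans (hR _ (hpow k)).2.1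
  rw [mul_pow, ← pow_mul, ← pow_mul, add_mul, one_mul, pow_add, mul_comm n k] at h1
  exact absurd (le_of_mul_le_mul_left h1 (by positivity)) hk.not_ge

/-- An increasing function of polynomial growth satisfies no inequality forcing exponential
growth. -/
theorem not_forall_exists_eventually_three_mul_le {T : ℝ → ℝ} (hmono : MonotoneOn T (Set.Ioi 0))
    (hT : Tendsto T atTop atTop) {n : ℕ} (hn : ∀ᶠ r in atTop, T r ≤ r ^ n) :
    ¬ ∀ ε > 0, ∃ K, ∀ᶠ r in atTop, 3 * T r ≤ 2 * (1 + ε) * T (r + 1) + ε * T (4 * r) + K := by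
  intro h
  set M : ℝ := 8 ^ (n + 1) with hM
  have hM1 : 1 ≤ M := one_le_pow₀ (by norm_num)
  -- For r in [r₀, 2r₀], where T(8r₀) ≤ M T(r₀), this ε gives εT(4r) ≤ T(r)/20. With K ≤ T(r)/20 the
  -- hypothesis becomes 2.9 T(r) ≤ 2.1 T(r+1), and 2.9/2.1 > 5/4.
  have hε : 0 < (20 * M)⁻¹ := by positivity
  have hεle : (20 * M)⁻¹ ≤ 1 / 20 := by
    rw [one_div]
    exact inv_anti₀ (by norm_num) (by linarith)
  obtain ⟨K, hK⟩ := h _ hε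
  obtain ⟨R, hR⟩ := eventually_atTop.1
    (hK.and ((hT.eventually_ge_atTop (max 1 (20 * K))).and (eventually_ge_atTop 1)))
  -- Taking r₀ ≥ k keeps all `k` steps inside [r₀, 2r₀]; they multiply T by more than `M`, yet T(r₀
  -- + k) ≤ T(8r₀).
  obtain ⟨k, hk⟩ := pow_unbounded_of_one_lt M (show (1 : ℝ) < 5 / 4 by norm_num)
  obtain ⟨r₀, hr₀T, hr₀⟩ := ((frequently_comp_eight_mul_le hT hn).and_eventually
    (eventually_ge_atTop (max R k))).exists
  have hr₀R : R ≤ r₀ := (le_max_left _ _).trans hr₀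
  have hr₀k : (k : ℝ) ≤ r₀ := (le_max_right _ _).trans hr₀
  have hr₀1 : 1 ≤ r₀ := (hR R le_rfl).2.2.trans hr₀R
  have hT1 : ∀ r, R ≤ r → 1 ≤ T r ∧ 20 * K ≤ T r := fun r hr ↦
    ⟨(le_max_left _ _).trans (hR r hr).2.1, (le_max_right _ _).trans (hR r hr).2.1⟩
  have mono : ∀ {x y}, r₀ ≤ x → x ≤ y → T x ≤ T y := fun {x y} hx hxy ↦
    hmono (by simp; linarith) (by simp; linarith) hxy
  have step : ∀ r, r₀ ≤ r → r ≤ 2 * r₀ → 5 / 4 * T r ≤ T (r + 1) := by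
    intro r h1 h2
    have e1 := (hR r (hr₀R.trans h1)).1
    have e2 := hT1 r (hr₀R.trans h1)
    have e3 : (20 * M)⁻¹ * T (4 * r) ≤ 1 / 20 * T r := by
      have : T (4 * r) ≤ M * T r :=
        (mono (by linarith) (by linarith)).trans (hr₀T.trans
          (mul_le_mul_of_nonneg_left (mono le_rfl h1) (by linarith)))
      calc _ ≤ (20 * M)⁻¹ * (M * T r) := mul_le_mul_of_nonneg_left this hε.le
        _ = 1 / 20 * T r := by field_simp
    have e4 : (20 * M)⁻¹ * T (r + 1) ≤ 1 / 20 * T (r + 1) :=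
      mul_le_mul_of_nonneg_right hεle (by linarith [(hT1 (r + 1) (by linarith)).1])
    linarith
  have iter : ∀ j : ℕ, (j : ℝ) ≤ r₀ → (5 / 4 : ℝ) ^ j * T r₀ ≤ T (r₀ + j) := by
    intro j
    induction j with
    | zero => simp
    | succ j ih =>
      intro hj
      push_cast at hj ⊢
      have h1 := ih (by linarith)
      have h2 := step (r₀ + j) (by linarith [j.cast_nonneg (α := ℝ)]) (by linarith)
      rw [pow_succ', mul_assoc, ← add_assoc]
      linarith
  have h1 := iter k hr₀k
  have h2 : T (r₀ + k) ≤ T (8 * r₀) := mono (by linarith [k.cast_nonneg (α := ℝ)]) (by linarith)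
  exact absurd (le_of_mul_le_mul_right (h1.trans (h2.trans hr₀T))
    (by linarith [(hT1 r₀ hr₀R).1])) hk.not_ge

/-- A meromorphic function of finite order has polynomially bounded characteristic. -/
lemma HasFiniteNevanlinnaOrder.exists_eventually_le_pow {f : ℂ → ℂ}
    (hf : HasFiniteNevanlinnaOrder f) :
    ∃ n : ℕ, ∀ᶠ r in atTop, ValueDistribution.characteristic f ⊤ r ≤ r ^ n := by
  obtain ⟨ρ, hρ, -⟩ := EReal.lt_iff_exists_real_btwn.1 hf
  obtain ⟨n, hn⟩ := exists_nat_ge ρ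
  refine ⟨n, ?_⟩
  filter_upwards [eventually_lt_of_limsup_lt hρ, eventually_gt_atTop 1] with r hr hr1
  set T := ValueDistribution.characteristic f ⊤ r
  have hlog : 0 < Real.log r := Real.log_pos hr1
  have hr' : Real.posLog T / Real.log r < ρ := by exact_mod_cast hr
  rw [div_lt_iff₀ hlog] at hr'
  rcases le_or_gt T 1 with h1 | h1
  · exact h1.trans (one_le_pow₀ hr1.le)
  · rw [← Real.log_le_log_iff (by linarith) (by positivity), Real.log_pow]
    calc Real.log T ≤ Real.posLog T := le_max_right _ _
      _ ≤ ρ * Real.log r := hr'.le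
      _ ≤ n * Real.log r := mul_le_mul_of_nonneg_right hn hlog.le

open MeromorphicOn ValueDistribution in
/-- The characteristic of a non-constant meromorphic function is unbounded. -/
lemma tendsto_characteristic_atTop {w : ℂ → ℂ} (hw : Meromorphic w)
    (htop : ∀ t u, meromorphicOrderAt (fun z ↦ w z - t) u ≠ ⊤) :
    Tendsto (characteristic w ⊤) atTop atTop := by
  classical
  -- Subtracting the value at a point of analyticity creates a zero, and a single zero already
  -- forces logarithmic growth of the counting function.
  obtain ⟨x, hx⟩ := (hw 0).eventually_analyticAt.exists
  set v : ℂ → ℂ := fun z ↦ w z - w x with hv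
  have hvm : Meromorphic v := hw.fun_sub (Meromorphic.const _)
  have hpos : 0 < meromorphicOrderAt v x := by
    have hva : AnalyticAt ℂ v x := hx.fun_sub analyticAt_const
    rw [← tendsto_zero_iff_meromorphicOrderAt_pos (hvm x)]
    have := hva.continuousAt.tendsto.mono_left (nhdsWithin_le_nhds (s := {x}ᶜ))
    simpa [hv] using this
  have hle : Function.locallyFinsuppWithin.single x 1 ≤ (divisor v Set.univ)⁺ := by
    intro z
    rw [Function.locallyFinsuppWithin.single_apply]
    split_ifs with hz
    · rw [hz, Function.locallyFinsuppWithin.posPart_apply,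
        divisor_apply hvm.meromorphicOn (Set.mem_univ _)]
      refine le_trans ?_ (le_posPart _)
      lift meromorphicOrderAt v x to ℤ using htop _ x with k
      have : 0 < k := by exact_mod_cast hpos
      rw [WithTop.untop₀_coe]
      omega
    · exact posPart_nonneg (divisor v Set.univ) z
  have hlow : Tendsto (fun r ↦ Real.log r - Real.log ‖x‖
      - max |Real.log ‖v 0‖| |Real.log ‖meromorphicTrailingCoeffAt v 0‖|
      - (Real.posLog ‖w x‖ + Real.log 2)) atTop atTop := by
    simp only [sub_eq_add_neg]
    exact tendsto_atTop_add_const_right _ _ (tendsto_atTop_add_const_right _ _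
      (tendsto_atTop_add_const_right _ _ Real.tendsto_log_atTop))
  refine tendsto_atTop_mono' _ ?_ hlow
  filter_upwards [eventually_ge_atTop 1, eventually_ge_atTop ‖x‖] with r hr1 hrx
  have h1 := Function.locallyFinsuppWithin.logCounting_le hle hr1
  rw [Function.locallyFinsuppWithin.logCounting_single_eq_log_sub_const hrx, Int.cast_one, one_mul,
    ← logCounting_zero, ← logCounting_inv] at h1
  have h2 : logCounting v⁻¹ ⊤ r ≤ characteristic v⁻¹ ⊤ r :=
    le_add_of_nonneg_left (proximity_nonneg r)
  have h3 := abs_le.1 (characteristic_sub_characteristic_inv_le hvm (R := r))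
  have h4 := abs_le.1 (abs_characteristic_sub_characteristic_shift_le hw (a₀ := w x) (r := r))
  linarith [h3.1, h4.1]

end Growth

/-- A non-constant meromorphic function takes no value identically near any point. -/
lemma IsNonconstantMeromorphic.meromorphicOrderAt_sub_const_ne_top {w : ℂ → ℂ}
    (hw : IsNonconstantMeromorphic w) (t u : ℂ) : meromorphicOrderAt (fun z ↦ w z - t) u ≠ ⊤ := by
  have hm : Meromorphic fun z ↦ w z - t := hw.1.fun_sub (Meromorphic.const t)
  -- Identity principle: infinite order at one point would mean infinite order everywhere.
  refine hm.exists_meromorphicOrderAt_ne_top_iff_forall.1 ?_ u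
  by_contra! h
  refine hw.2 ⟨t, ?_⟩
  change ∀ᶠ z in codiscrete ℂ, w z = t
  rw [eventually_codiscrete_iff]
  intro x
  filter_upwards [meromorphicOrderAt_eq_top_iff.1 (h x)] with z hz
  exact sub_eq_zero.1 hz

/-- The right side is irreducible in `w`: its numerator and denominator, as polynomials in `w`
over `ℂ`, have no common factor. -/
theorem mainTheorem7 (a₀ a₂ : ℂ)
    (hirr : IsCoprime (C a₂ * X ^ 2 + C a₀ : ℂ[X]) (1 - X ^ 2))
    (w : ℂ → ℂ) (hw : IsNonconstantMeromorphic w) (hord : HasFiniteNevanlinnaOrder w)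
    (heq : MeromorphicEq (fun z => w (z + 1) + w (z - 1))
      (fun z => (a₂ * w z ^ 2 + a₀) / (1 - w z ^ 2))) :
    a₂ = 0 := by
  by_contra ha₂
  have ha : a₂ + a₀ ≠ 0 := by
    intro h0
    obtain ⟨p, q, hpq⟩ := hirr
    have := congrArg (Polynomial.eval 1) hpq
    simp [h0] at this
  obtain ⟨s, hs, has⟩ : ∃ s : ℂ, s ^ 2 = 1 ∧ a₂ ≠ 2 * s := by
    by_cases h : a₂ = 2
    · exact ⟨-1, by norm_num, by rw [h]; norm_num⟩
    · exact ⟨1, by norm_num, by simpa using h⟩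
  have htop := hw.meromorphicOrderAt_sub_const_ne_top
  obtain ⟨n, hn⟩ := hord.exists_eventually_le_pow
  refine not_forall_exists_eventually_three_mul_le
    (ValueDistribution.characteristic_monotoneOn hw.1)
    (tendsto_characteristic_atTop hw.1 htop) hn fun ε hε ↦ ?_
  obtain ⟨K₁, hK₁⟩ := exists_logCounting_sub_add_two_mul_le hw.1 hs ha ha₂ has heq htop hε
  -- The bound for `s` is used once and the one for `-s` twice, so ε/3 in each adds up to ε.
  obtain ⟨K₂, hK₂⟩ := exists_eventually_characteristic_le_logCounting_add hw.1 hs ha heq (htop s)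
    (ε := ε / 3) (by positivity)
  obtain ⟨K₃, hK₃⟩ := exists_eventually_characteristic_le_logCounting_add hw.1
    (by rw [neg_sq, hs]) ha heq (htop (-s)) (ε := ε / 3) (by positivity)
  refine ⟨K₁ + K₂ + 2 * K₃, ?_⟩
  filter_upwards [hK₂, hK₃, eventually_ge_atTop 1] with r h2 h3 hr
  have h4 : 2 * (1 + ε) * ValueDistribution.logCounting w ⊤ (r + 1)
      ≤ 2 * (1 + ε) * ValueDistribution.characteristic w ⊤ (r + 1) :=
    mul_le_mul_of_nonneg_left (le_add_of_nonneg_left (ValueDistribution.proximity_nonneg _))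
      (by positivity)
  linarith [hK₁ r hr]
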